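/- Let $m,n$ be integers with $0\le m\le n$ and let $z\in\mathbb C\setminus(-\infty,1]$, with phases fixed by $-\pi<\arg(z\pm1)<\pi$; in particular $\left(\frac{z^2-1}{4}\right)^{s}=\left(\frac{z-1}{2}\right)^{s}\left(\frac{z+1}{2}\right)^{s}$ with principal powers. Let $\psi=\Gamma'/\Gamma$ be the digamma function, and let $P_\nu^m(z)$ be Hobson's associated Legendre function of the first kind, $$P_\nu^m(z)=\frac{\Gamma(\nu+m+1)}{\Gamma(\nu+1)}\,\frac{(z^2-1)^{m/2}}{2^{\nu}\,2\pi i}\oint (t^2-1)^{\nu}(t-z)^{-\nu-m-1}\,dt ,$$ the contour being a circle that encircles $1$ and $z$ once counterclockwise, has the cut $(-\infty,-1]$ outside, and with $\arg(t\pm1)=0$, $|\arg(t-z)|<\pi$ at the real points $t>1$ of the contour. Let $Q_n^m(z)$ be Hobson's associated Legendre function of the second kind, i.e. for $\mathrm{Im}(z)\gtrless0$ $$Q_n^m(z)=\lim_{\nu\to n}\frac{\pi}{2}e^{i\pi m}\,\frac{e^{\mp i\pi\nu}P_\nu^m(z)-P_\nu^m(-z)}{\sin[\pi(\nu+m)]},$$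 and, for real $z>1$, the limit of $Q_n^m(w)$ as $w\to z$ through non-real $w$. Then these limits exist, and for each of the two choices of sign (all upper signs, or all lower signs) \begin{align*} Q_n^m(z)={}&\frac12P_n^m(z)\ln\frac{z+1}{z-1}\mp\frac12\left[\psi(n+m+1)+\psi(n+1)\right]P_n^m(z)\\ &\pm\frac{(\pm1)^n(\mp1)^m}{2}\frac{(n+m)!}{(n-m)!}\left(\frac{z^2-1}{4}\right)^{-m/2}\sum_{k=0}^{m-1}(\mp1)^k\frac{(k+n-m)!\,(m-k-1)!}{k!\,(n+m-k)!}\left(\frac{z\mp1}{2}\right)^k\\ &\pm\frac{(\pm1)^{n+m}}{2}\left(\frac{z^2-1}{4}\right)^{m/2}\sum_{k=0}^{n-m}(\pm1)^k\frac{(k+n+m)!\,\psi(k+n+m+1)}{k!\,(k+m)!\,(n-m-k)!}\left(\frac{z\mp1}{2}\right)^k\\ &\mp\frac{(\pm1)^n}{2}\frac{(n+m)!}{(n-m)!}\left(\frac{z\mp1}{z\pm1}\right)^{m/2}\sum_{k=0}^{n}(\pm1)^k\frac{(k+n)!}{k!\,(k+m)!\,(n-k)!}\left[\psi(k+n+1)-\psi(k+m+1)-\psi(k+1)\right]\left(\frac{z\mp1}{2}\right)^k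 , \end{align*} where the logarithm and the power of $\frac{z\mp1}{z\pm1}$ are principal and the empty sum (for $m=0$) is $0$. -/

import Mathlib

/-- For `z` off the ray `(-∞, -1]` there is a circle enclosing the points `1` and `z` such that
the closed disc bounded by it does not meet the ray `(-∞, -1]`. -/
theorem exists_schlafliCircle (z : ℂ) (hz : z + 1 ∈ Complex.slitPlane) :
    ∃ p : ℂ × ℝ, 1 ∈ Metric.ball p.1 p.2 ∧ z ∈ Metric.ball p.1 p.2 ∧
      ∀ t ∈ Metric.closedBall p.1 p.2, t + 1 ∈ Complex.slitPlane := by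
  set w : ℂ := z + 1 with hw
  set ρ : ℝ := ‖w‖ with hρ
  have hw0 : w ≠ 0 := Complex.slitPlane_ne_zero hz
  have hρ0 : 0 < ρ := norm_pos_iff.mpr hw0
  have hsq : ρ ^ 2 = w.re ^ 2 + w.im ^ 2 := by
    rw [hρ, Complex.sq_norm, Complex.normSq_apply]; ring
  have hu : 0 < ρ + w.re := by
    rcases Complex.mem_slitPlane_iff.mp hz with h | h
    · linarith
    · have h2 : 0 < w.im ^ 2 := by positivity
      by_contra hcon
      nlinarith
  set S : ℝ := (ρ + 2) / (2 * (ρ + w.re)) with hS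
  have hS0 : 0 < S := by positivity
  have hS1 : 2 * (S * (ρ + w.re)) = ρ + 2 := by
    rw [hS]; field_simp
  set a : ℝ := S * (ρ + w.re) with ha
  set b : ℝ := S * w.im with hb
  have ha0 : 0 < a := by positivity
  have hzre : z.re = w.re - 1 := by simp [hw]
  have hzim : z.im = w.im := by simp [hw]
  have hN : ∀ t : ℂ, dist t ⟨a, b⟩ ^ 2 = (t.re - a) ^ 2 + (t.im - b) ^ 2 := by
    intro t
    rw [dist_eq_norm, Complex.sq_norm, Complex.normSq_apply]
    simp only [Complex.sub_re, Complex.sub_im]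
    ring
  have h1 : dist (1 : ℂ) ⟨a, b⟩ < dist (-1 : ℂ) ⟨a, b⟩ := by
    refine lt_of_pow_lt_pow_left₀ 2 dist_nonneg ?_
    rw [hN, hN]
    simp
    nlinarith
  have h2 : dist z ⟨a, b⟩ < dist (-1 : ℂ) ⟨a, b⟩ := by
    refine lt_of_pow_lt_pow_left₀ 2 dist_nonneg ?_
    rw [hN, hN, hzre, hzim]
    simp only [Complex.neg_re, Complex.neg_im, Complex.one_re, Complex.one_im]
    have key : 2 * (a * w.re + b * w.im) = ρ ^ 2 + 2 * ρ := by
      have e : a * w.re + b * w.im = ρ * a := by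
        have e1 : b * w.im = S * (ρ ^ 2 - w.re ^ 2) := by rw [hb, hsq]; ring
        rw [e1, ha]; ring
      rw [e]; linear_combination ρ * hS1
    nlinarith
  obtain ⟨R, hR1, hR2⟩ := exists_between (max_lt h1 h2)
  refine ⟨(⟨a, b⟩, R), lt_of_le_of_lt (le_max_left _ _) hR1,
    lt_of_le_of_lt (le_max_right _ _) hR1, ?_⟩
  intro t ht
  by_contra hcon
  rw [Complex.mem_slitPlane_iff] at hcon
  push Not at hcon
  simp only [Complex.add_re, Complex.add_im, Complex.one_re, Complex.one_im, add_zero] at hcon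
  have h3 : dist t ⟨a, b⟩ < dist (-1 : ℂ) ⟨a, b⟩ :=
    lt_of_le_of_lt (Metric.mem_closedBall.mp ht) hR2
  have h4 : dist t ⟨a, b⟩ ^ 2 < dist (-1 : ℂ) ⟨a, b⟩ ^ 2 :=
    pow_lt_pow_left₀ h3 dist_nonneg two_ne_zero
  rw [hN, hN, hcon.2] at h4
  simp only [Complex.neg_re, Complex.neg_im, Complex.one_re, Complex.one_im] at h4
  nlinarith [hcon.1]

open Classical in
/-- Hobson's associated Legendre function of the first kind `P_ν^m(z)` of complex degree `ν` and
natural order `m`, for `z` in the plane cut along `(-∞, 1]`, by Schläfli's contour integral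
`P_ν^m(z) = Γ(ν+m+1)/Γ(ν+1) (z²-1)^{m/2} (2πi)⁻¹ ∮ 2^{-ν} (t²-1)^ν (t-z)^{-ν-m-1} dt`
over a circle enclosing `1` and `z` counterclockwise and leaving the cut `(-∞, -1]` outside (by
Cauchy's theorem the choice of that circle is immaterial).
Here `Γ(ν+m+1)/Γ(ν+1) = (ν+1)(ν+2)⋯(ν+m)`, and `2^{-ν} (t²-1)^ν (t-z)^{-ν}` is written as
`((t-1)/(t-z))^ν ((t+1)/2)^ν` with principal powers: its first factor is holomorphic in `t` off
the segment from `1` to `z`, the second one off the cut `(-∞, -1]`; this is the branch with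
`arg (t-1) = arg (t+1) = 0` and `|arg (t-z)| < π` at the real points `t > 1` of the contour.
`(z²-1)^{m/2}` means `(z-1)^{m/2} (z+1)^{m/2}` with `arg (z-1)` and `arg (z+1)` in `(-π, π)`. -/
noncomputable def legendreP (ν : ℂ) (m : ℕ) (z : ℂ) : ℂ :=
  if hz : z + 1 ∈ Complex.slitPlane then
    (ascPochhammer ℂ m).eval (ν + 1) *
      ((z - 1) ^ ((m : ℂ) / 2) * (z + 1) ^ ((m : ℂ) / 2)) *
      ((2 * (Real.pi : ℂ) * Complex.I)⁻¹ *
        circleIntegral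
          (fun t : ℂ => ((t - 1) / (t - z)) ^ ν * ((t + 1) / 2) ^ ν / (t - z) ^ (m + 1))
          (exists_schlafliCircle z hz).choose.1 (exists_schlafliCircle z hz).choose.2)
  else 0

/-- The quotient
`(π/2) e^{iπm} (e^{∓iπν} P_ν^m(z) - P_ν^m(-z)) / sin (π(ν+m))`, upper sign for `Im z > 0`, lower
sign for `Im z < 0`, which for non-real `z` and non-integer `ν` is Hobson's associated Legendre
function of the second kind `Q_ν^m(z)`. -/
noncomputable def legendreQQuot (ν : ℂ) (m : ℕ) (z : ℂ) : ℂ :=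
  (Real.pi : ℂ) / 2 * Complex.exp (Complex.I * Real.pi * m) *
    ((Complex.exp (-(Real.sign z.im : ℂ) * Complex.I * Real.pi * ν) * legendreP ν m z
        - legendreP ν m (-z)) /
      Complex.sin (Real.pi * (ν + m)))

/-- Hobson's associated Legendre function of the second kind `Q_ν^m(z)` for `z` in the plane cut
along `(-∞, 1]`: for non-real `z` it is the limit of the quotient `legendreQQuot` at `ν` (so that
the removable singularities at the integers are removed), and at a real point `z > 1` it is the
limit from the non-real points. -/
noncomputable def legendreQ (ν : ℂ) (m : ℕ) (z : ℂ) : ℂ :=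
  if z.im ≠ 0 then
    Filter.limUnder (nhdsWithin ν {ν}ᶜ) (fun ν' : ℂ => legendreQQuot ν' m z)
  else
    Filter.limUnder (nhdsWithin z {w : ℂ | w.im ≠ 0}) (fun w : ℂ =>
      Filter.limUnder (nhdsWithin ν {ν}ᶜ) (fun ν' : ℂ => legendreQQuot ν' m w))

/-- `((z²-1)/4)^s`, formed with `arg (z-1)` and `arg (z+1)` in `(-π, π)`. -/
noncomputable def quarterPow (z s : ℂ) : ℂ :=
  ((z - 1) / 2) ^ s * ((z + 1) / 2) ^ s

/-! Put N = n + m, A = (z-1)^{m/2} (z+1)^{m/2}, and let f_j be the Taylor coefficients of (t²-1)^n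
at z (`legendreTaylor`).

Analysis. At ν = n both the numerator and the sine vanish, so Q is a quotient of ν-derivatives, and
the derivative of Schläfli's integral at ν = n is needed. It inserts log((t-1)/(t-z)) + log((t+1)/2)
into the integral of 2^{-n} Σ f_j (t-z)^{j-N-1}. The first logarithm is holomorphic outside the
circle and vanishes at infinity, so only j > N contributes; the second is holomorphic inside, so
only j ≤ N does (`exists_legendreP_eq_mul`). With Φ_N(a) = Σ_{j≠N} f_j (-a)^{j-N}/(j-N), the point z
thus yields the half j < N of Φ_N(z+1) and the half j > N of Φ_N(z-1). Passing to -z exchanges z+1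
and z-1 up to sign and supplies the missing halves, whence (`tendsto_legendreQQuot`) Q = ½ (n+1)_m A
2^{-n} [f_N (log((z+1)/2) - log((z-1)/2)) + Φ_N(z+1) - Φ_N(z-1)]. This expression is continuous
across the real points z > 1, which settles those points.

Algebra. The two signs are ε = ±1, and Φ_N(z+ε) - Φ_N(z-ε) is odd in ε. The symmetry j ↦ 2n-j
(`legendreTaylor_reflect`) brings it to a form in which expanding each f_j in powers of z-ε leaves
inner sums that evaluate to harmonic numbers, apart from a Beta-type sum that produces the finite
sum over k < m (`legendrePhi_sub_eq_sum`). Since ψ(k+1) = H_k - γ, these are the digamma sums of the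
formula; the surplus multiples of f_N form the term with ψ(n+m+1) + ψ(n+1). -/

/-! ### Taylor coefficients of (X² - 1)^n. -/

/-- The Taylor coefficient of order `j` at the point `z` of the polynomial `(X² - 1) ^ n`. -/
noncomputable def legendreTaylor (n j : ℕ) (z : ℂ) : ℂ :=
  (Polynomial.taylor z (((Polynomial.X : Polynomial ℂ) ^ 2 - 1) ^ n)).coeff j

theorem continuous_legendreTaylor (n j : ℕ) : Continuous (legendreTaylor n j) := by
  have : legendreTaylor n j = fun z => (Polynomial.hasseDeriv j
      (((Polynomial.X : Polynomial ℂ) ^ 2 - 1) ^ n)).eval z := by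
    funext z
    rw [legendreTaylor, Polynomial.taylor_coeff]
  rw [this]
  exact Polynomial.continuous _

theorem natDegree_sq_sub_one_pow (n : ℕ) :
    (((Polynomial.X : Polynomial ℂ) ^ 2 - 1) ^ n).natDegree = 2 * n := by
  have h : ((Polynomial.X : Polynomial ℂ) ^ 2 - 1).natDegree = 2 := by compute_degree!
  rw [Polynomial.natDegree_pow, h, mul_comm]

theorem sum_legendreTaylor (n : ℕ) (z t : ℂ) :
    ∑ j ∈ Finset.range (2 * n + 1), legendreTaylor n j z * (t - z) ^ j = (t ^ 2 - 1) ^ n := by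
  have h := Polynomial.eval_eq_sum_range' (p := Polynomial.taylor z
    (((Polynomial.X : Polynomial ℂ) ^ 2 - 1) ^ n)) (n := 2 * n + 1)
    (by rw [Polynomial.natDegree_taylor, natDegree_sq_sub_one_pow]; omega) (t - z)
  rw [Polynomial.taylor_eval] at h
  simp only [legendreTaylor]
  rw [← h]
  simp

theorem legendreTaylor_neg (n j : ℕ) (z : ℂ) :
    legendreTaylor n j (-z) = (-1) ^ j * legendreTaylor n j z := by
  have h : Polynomial.taylor (-z) (((Polynomial.X : Polynomial ℂ) ^ 2 - 1) ^ n) =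
      (Polynomial.taylor z (((Polynomial.X : Polynomial ℂ) ^ 2 - 1) ^ n)).comp
        (Polynomial.C (-1) * Polynomial.X) := by
    simp only [Polynomial.taylor_apply, Polynomial.pow_comp, Polynomial.sub_comp,
      Polynomial.X_comp, Polynomial.one_comp, Polynomial.add_comp, Polynomial.C_comp, map_neg,
      map_one]
    congr 1
    ring
  rw [legendreTaylor, h, Polynomial.comp_C_mul_X_coeff, legendreTaylor, mul_comm]

/-- With c = z² - 1 the quadratic q = X² + 2zX + c satisfies q(cX) = c (cX² + 2zX + 1), which is c
times its reversal; the coefficients of the n-th powers are then compared. For j = n + m this is the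
symmetry between the orders m and -m. -/
theorem legendreTaylor_reflect (n j : ℕ) (hj : j ≤ 2 * n) (z : ℂ) :
    legendreTaylor n j z * (z ^ 2 - 1) ^ j =
      (z ^ 2 - 1) ^ n * legendreTaylor n (2 * n - j) z := by
  set q : Polynomial ℂ := Polynomial.taylor z ((Polynomial.X : Polynomial ℂ) ^ 2 - 1) with hq
  have hq' : q = Polynomial.X ^ 2 + Polynomial.C (2 * z) * Polynomial.X +
      Polynomial.C (z ^ 2 - 1) := by
    rw [hq]
    simp only [Polynomial.taylor_apply, Polynomial.pow_comp,
      Polynomial.X_comp, Polynomial.one_comp, map_mul, map_sub, map_pow, map_one, map_ofNat]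
    ring
  have hqd : q.natDegree = 2 := by
    rw [hq, Polynomial.natDegree_taylor]; compute_degree!
  have hr : q.comp (Polynomial.C (z ^ 2 - 1) * Polynomial.X) =
      Polynomial.C (z ^ 2 - 1) * Polynomial.reflect 2 q := by
    ext i
    rw [Polynomial.comp_C_mul_X_coeff, Polynomial.coeff_C_mul, Polynomial.coeff_reflect]
    by_cases hi : i ≤ 2
    · rw [Polynomial.revAt_le hi, hq']
      generalize z ^ 2 - 1 = c
      interval_cases i <;> simp [Polynomial.coeff_X, Polynomial.coeff_C] <;>
        ring
    · have h2 : Polynomial.revAt 2 i = i := Polynomial.revAt_eq_self_of_lt (by omega)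
      rw [h2, Polynomial.coeff_eq_zero_of_natDegree_lt (by omega)]
      simp
  have hn : ∀ k : ℕ, (q ^ k).natDegree ≤ 2 * k := fun k => by
    rw [Polynomial.natDegree_pow, hqd, mul_comm]
  have hrn : ∀ k : ℕ, Polynomial.reflect (2 * k) (q ^ k) = (Polynomial.reflect 2 q) ^ k := by
    intro k
    induction k with
    | zero => simp
    | succ k ih =>
      rw [pow_succ, mul_add, mul_one, Polynomial.reflect_mul _ _ (hn k) hqd.le, ih, pow_succ]
  have hT : ∀ i, legendreTaylor n i z = (q ^ n).coeff i := by
    intro i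
    rw [legendreTaylor, hq, Polynomial.taylor_pow]
  rw [hT, hT, ← Polynomial.comp_C_mul_X_coeff, Polynomial.pow_comp, hr, mul_pow, ← hrn,
    ← Polynomial.C_pow, Polynomial.coeff_C_mul, Polynomial.coeff_reflect,
    Polynomial.revAt_le hj]

theorem legendreTaylor_eq_sum (n j : ℕ) (z ε : ℂ) (hε : ε ^ 2 = 1) :
    legendreTaylor n j z = ∑ k ∈ Finset.range (n + 1),
      (n.choose k * (2 * ε) ^ (n - k)) * ((n + k).choose j * (z - ε) ^ (n + k - j)) := by
  have h : Polynomial.taylor z (((Polynomial.X : Polynomial ℂ) ^ 2 - 1) ^ n) =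
      ∑ k ∈ Finset.range (n + 1), Polynomial.C (n.choose k * (2 * ε) ^ (n - k)) *
        (Polynomial.X + Polynomial.C (z - ε)) ^ (n + k) := by
    -- Factorisation about the root ε, with second root -ε; the only use of ε² = 1.
    have e : (Polynomial.X + Polynomial.C z : Polynomial ℂ) ^ 2 - 1 =
        (Polynomial.X + Polynomial.C (z - ε)) *
          ((Polynomial.X + Polynomial.C (z - ε)) + Polynomial.C (2 * ε)) := by
      have h1 : (1 : Polynomial ℂ) = Polynomial.C ε ^ 2 := by
        rw [← Polynomial.C_pow, hε, map_one]
      rw [h1]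
      simp only [map_sub, map_mul, map_ofNat]
      ring
    rw [Polynomial.taylor_apply]
    simp only [Polynomial.pow_comp, Polynomial.sub_comp, Polynomial.X_comp, Polynomial.one_comp]
    rw [e, mul_pow, add_pow (Polynomial.X + Polynomial.C (z - ε)) (Polynomial.C (2 * ε)),
      Finset.mul_sum]
    refine Finset.sum_congr rfl fun k _ => ?_
    simp only [map_mul, map_pow, map_natCast]
    ring
  rw [legendreTaylor, h, Polynomial.finsetSum_coeff]
  refine Finset.sum_congr rfl fun k _ => ?_
  rw [Polynomial.coeff_C_mul, Polynomial.coeff_X_add_C_pow]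
  ring

/-! ### Binomial sums and harmonic numbers. -/

/-- A Pascal-type induction evaluates the upper part of a binomial expansion of `(x + v) ^ p`
integrated term by term in `v`. -/
theorem sum_choose_mul_pow_div (x v : ℂ) (p M : ℕ) :
    ∑ i ∈ Finset.range (p + 1),
        (if M < i then (p.choose i : ℂ) * x ^ (p - i) * v ^ (i - M) / ((i : ℂ) - M) else 0) =
      ∑ Q ∈ Finset.range p,
        (Q.choose M : ℂ) * (x + v) ^ (p - Q) * x ^ (Q - M) / ((p : ℂ) - Q) +
      p.choose M * ((harmonic M : ℂ) - harmonic p) * x ^ (p - M) := by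
  induction p generalizing M with
  | zero => 
    cases M <;> simp
  | succ p ih =>
    cases M with
    | zero =>
      -- For M = 0 Pascal's rule leaves Σ C(p,i) x^{p-i} v^{i+1}/(i+1), which is summed by
      -- C(p,i)/(i+1) = C(p+1,i+1)/(p+1).
      have h1 : ∑ i ∈ Finset.range (p + 1 + 1), (if 0 < i then ((p + 1).choose i : ℂ) *
            x ^ (p + 1 - i) * v ^ (i - 0) / ((i : ℂ) - (0 : ℕ)) else 0) =
          x * ∑ i ∈ Finset.range (p + 1), (if 0 < i then (p.choose i : ℂ) * x ^ (p - i) *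
            v ^ (i - 0) / ((i : ℂ) - (0 : ℕ)) else 0) +
          ((x + v) ^ (p + 1) - x ^ (p + 1)) / (p + 1) := by
        have h2 : x * ∑ i ∈ Finset.range (p + 1), (if 0 < i then (p.choose i : ℂ) * x ^ (p - i) *
            v ^ (i - 0) / ((i : ℂ) - (0 : ℕ)) else 0) = ∑ i ∈ Finset.range (p + 1),
            (p.choose (i + 1) : ℂ) * x ^ (p - i) * v ^ (i + 1) / ((i : ℂ) + 1) := by
          rw [Finset.sum_range_succ' _ p, Finset.sum_range_succ _ p, mul_add, Finset.mul_sum]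
          simp only [Nat.choose_succ_self, lt_irrefl, if_false, Nat.cast_zero, zero_mul, zero_div,
            mul_zero, add_zero]
          refine Finset.sum_congr rfl fun i hi => ?_
          have hi' := Finset.mem_range.mp hi
          rw [if_pos (by omega), show p - i = p - (i + 1) + 1 by omega]
          push_cast
          simp only [sub_zero]
          ring
        rw [h2, Finset.sum_range_succ' _ (p + 1)]
        have h3 : ((x + v) ^ (p + 1) - x ^ (p + 1)) / ((p : ℂ) + 1) =
            ∑ i ∈ Finset.range (p + 1), (p.choose i : ℂ) * x ^ (p - i) * v ^ (i + 1) /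
              ((i : ℂ) + 1) := by
          rw [add_comm x v, add_pow, Finset.sum_range_succ' _ (p + 1)]
          simp only [pow_zero, one_mul, Nat.sub_zero, Nat.choose_zero_right, Nat.cast_one, mul_one,
            add_sub_cancel_right]
          rw [Finset.sum_div]
          refine Finset.sum_congr rfl fun i _ => ?_
          have hp : ((p : ℂ) + 1) ≠ 0 := Nat.cast_add_one_ne_zero p
          have hi : ((i : ℂ) + 1) ≠ 0 := Nat.cast_add_one_ne_zero i
          have hc : ((p : ℂ) + 1) * p.choose i = (p + 1).choose (i + 1) * ((i : ℂ) + 1) := by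
            exact_mod_cast Nat.add_one_mul_choose_eq p i
          rw [Nat.add_sub_add_right, div_eq_div_iff hp hi]
          linear_combination (-(v ^ (i + 1) * x ^ (p - i))) * hc
        rw [h3, ← Finset.sum_add_distrib]
        simp only [lt_irrefl, if_false, add_zero]
        refine Finset.sum_congr rfl fun i _ => ?_
        rw [if_pos (by omega), Nat.choose_succ_succ, Nat.add_sub_add_right]
        push_cast
        simp only [sub_zero]
        ring
      rw [h1, ih, Finset.sum_range_succ' _ p, harmonic_succ, mul_add, Finset.mul_sum]
      have h4 : ∀ Q ∈ Finset.range p, ((Q + 1).choose 0 : ℂ) * (x + v) ^ (p + 1 - (Q + 1)) *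
            x ^ (Q + 1 - 0) / (((p + 1 : ℕ) : ℂ) - ((Q + 1 : ℕ) : ℂ)) =
          x * ((Q.choose 0 : ℂ) * (x + v) ^ (p - Q) * x ^ (Q - 0) / ((p : ℂ) - Q)) := by
        intro Q _
        rw [Nat.add_sub_add_right]
        push_cast
        simp only [Nat.sub_zero, Nat.choose_zero_right, Nat.cast_one, one_mul,
          add_sub_add_right_eq_sub]
        ring
      rw [Finset.sum_congr rfl h4]
      simp only [Nat.sub_zero, Nat.choose_zero_right, Nat.cast_one, one_mul, Nat.cast_zero,
        sub_zero, pow_zero, mul_one, harmonic_zero, Rat.cast_zero]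
      push_cast
      ring
    | succ M =>
      -- Calling the left side S(p, M), Pascal's rule reads S(p+1, M+1) = x S(p, M+1) + S(p, M).
      have h1 : ∑ i ∈ Finset.range (p + 1 + 1), (if M + 1 < i then ((p + 1).choose i : ℂ) *
            x ^ (p + 1 - i) * v ^ (i - (M + 1)) / ((i : ℂ) - ((M + 1 : ℕ) : ℂ)) else 0) =
          x * ∑ i ∈ Finset.range (p + 1), (if M + 1 < i then (p.choose i : ℂ) * x ^ (p - i) *
            v ^ (i - (M + 1)) / ((i : ℂ) - ((M + 1 : ℕ) : ℂ)) else 0) +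
          ∑ i ∈ Finset.range (p + 1), (if M < i then (p.choose i : ℂ) * x ^ (p - i) *
            v ^ (i - M) / ((i : ℂ) - M) else 0) := by
        have h2 : x * ∑ i ∈ Finset.range (p + 1), (if M + 1 < i then (p.choose i : ℂ) *
            x ^ (p - i) * v ^ (i - (M + 1)) / ((i : ℂ) - ((M + 1 : ℕ) : ℂ)) else 0) =
            ∑ i ∈ Finset.range (p + 1), (if M < i then (p.choose (i + 1) : ℂ) *
            x ^ (p - i) * v ^ (i - M) / ((i : ℂ) - M) else 0) := by
          rw [Finset.sum_range_succ' _ p, Finset.sum_range_succ _ p, mul_add, Finset.mul_sum]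
          simp only [Nat.choose_succ_self, Nat.cast_zero, zero_mul, zero_div, ite_self, add_zero,
            not_lt_zero, if_false, mul_zero]
          refine Finset.sum_congr rfl fun i hi => ?_
          have hi' := Finset.mem_range.mp hi
          by_cases hM : M < i
          · rw [if_pos (by omega), if_pos hM, show p - i = p - (i + 1) + 1 by omega,
              Nat.add_sub_add_right]
            push_cast
            rw [add_sub_add_right_eq_sub]
            ring
          · rw [if_neg (by omega), if_neg hM, mul_zero]
        rw [h2, Finset.sum_range_succ' _ (p + 1), ← Finset.sum_add_distrib]
        simp only [not_lt_zero, if_false, add_zero]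
        refine Finset.sum_congr rfl fun i _ => ?_
        by_cases hM : M < i
        · rw [if_pos (by omega), if_pos hM, if_pos hM, Nat.choose_succ_succ,
            Nat.add_sub_add_right, Nat.add_sub_add_right]
          push_cast
          rw [add_sub_add_right_eq_sub]
          ring
        · rw [if_neg (by omega), if_neg hM, if_neg hM, add_zero]
      rw [h1, ih, ih, Finset.sum_range_succ' _ p]
      have h4 : ∀ Q ∈ Finset.range p, ((Q + 1).choose (M + 1) : ℂ) *
            (x + v) ^ (p + 1 - (Q + 1)) * x ^ (Q + 1 - (M + 1)) /
              (((p + 1 : ℕ) : ℂ) - ((Q + 1 : ℕ) : ℂ)) =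
          x * ((Q.choose (M + 1) : ℂ) * (x + v) ^ (p - Q) * x ^ (Q - (M + 1)) / ((p : ℂ) - Q)) +
          (Q.choose M : ℂ) * (x + v) ^ (p - Q) * x ^ (Q - M) / ((p : ℂ) - Q) := by
        intro Q _
        -- Where natural subtraction truncates (Q ≤ M), the binomial coefficient is zero.
        have h5 : (Q.choose (M + 1) : ℂ) * x ^ (Q - M) =
            x * ((Q.choose (M + 1) : ℂ) * x ^ (Q - (M + 1))) := by
          by_cases hQ : M + 1 ≤ Q
          · rw [show Q - M = Q - (M + 1) + 1 by omega]; ring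
          · rw [Nat.choose_eq_zero_of_lt (by omega)]; simp
        rw [Nat.choose_succ_succ, Nat.add_sub_add_right, Nat.add_sub_add_right]
        push_cast
        rw [add_sub_add_right_eq_sub]
        linear_combination ((x + v) ^ (p - Q) / ((p : ℂ) - Q)) * h5
      rw [Finset.sum_congr rfl h4, Finset.sum_add_distrib, ← Finset.mul_sum]
      -- The harmonic part obeys the same recursion: the new terms 1/(M+1) and 1/(p+1) balance
      -- because (p+1) C(p,M) = (M+1) C(p+1,M+1).
      have h6 : ((p + 1).choose (M + 1) : ℂ) * ((harmonic (M + 1) : ℂ) - harmonic (p + 1)) *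
            x ^ (p + 1 - (M + 1)) =
          x * (p.choose (M + 1) * ((harmonic (M + 1) : ℂ) - harmonic p) * x ^ (p - (M + 1))) +
          p.choose M * ((harmonic M : ℂ) - harmonic p) * x ^ (p - M) := by
        have h5 : (p.choose (M + 1) : ℂ) * x ^ (p - M) =
            x * ((p.choose (M + 1) : ℂ) * x ^ (p - (M + 1))) := by
          by_cases hQ : M + 1 ≤ p
          · rw [show p - M = p - (M + 1) + 1 by omega]; ring
          · rw [Nat.choose_eq_zero_of_lt (by omega)]; simp
        have hc : ((p : ℂ) + 1) * p.choose M = (p.choose M + p.choose (M + 1)) * ((M : ℂ) + 1) := by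
          exact_mod_cast Nat.add_one_mul_choose_eq p M
        have hp : ((p : ℂ) + 1) ≠ 0 := Nat.cast_add_one_ne_zero p
        have hM : ((M : ℂ) + 1) ≠ 0 := Nat.cast_add_one_ne_zero M
        have hc' : (p.choose M : ℂ) * ((M : ℂ) + 1)⁻¹ =
            (p.choose M + p.choose (M + 1)) * ((p : ℂ) + 1)⁻¹ := by
          field_simp
          linear_combination hc
        rw [Nat.choose_succ_succ, Nat.add_sub_add_right, harmonic_succ, harmonic_succ]
        push_cast
        linear_combination ((harmonic M : ℂ) + ((M : ℂ) + 1)⁻¹ - harmonic p) * h5 +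
          x ^ (p - M) * hc'
      rw [h6]
      simp only [Nat.choose_zero_succ, Nat.cast_zero, zero_mul, zero_div, add_zero]
      ring

/-- The case x = 1, v = -1: every term with Q < p carries a positive power of x + v = 0. -/
theorem sum_choose_neg_one_pow_div (p M : ℕ) :
    ∑ i ∈ Finset.range (p + 1),
        (if M < i then (p.choose i : ℂ) * (-1) ^ (i - M) / ((i : ℂ) - M) else 0) =
      p.choose M * ((harmonic M : ℂ) - harmonic p) := by
  have h := sum_choose_mul_pow_div 1 (-1) p M
  simp only [one_pow, mul_one, add_neg_cancel] at h
  rw [h, Finset.sum_eq_zero, zero_add]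
  intro Q hQ
  have := Finset.mem_range.mp hQ
  rw [zero_pow (by omega)]
  simp

/-- The part i > M gives H_M - H_p; the part i < M becomes, under i ↦ p - i, minus the same sum with
p - M for M, so H_p cancels. The term i = M is zero because x / 0 = 0. -/
theorem sum_choose_neg_one_zpow_div (p M : ℕ) (hM : M ≤ p) :
    ∑ i ∈ Finset.range (p + 1), (p.choose i : ℂ) * (-1) ^ ((i : ℤ) - M) / ((i : ℂ) - M) =
      p.choose M * ((harmonic M : ℂ) - harmonic (p - M)) := by
  have h1 := sum_choose_neg_one_pow_div p M
  have h2 := sum_choose_neg_one_pow_div p (p - M)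
  rw [← Finset.sum_range_reflect] at h2
  have h3 : ∑ i ∈ Finset.range (p + 1), (p.choose i : ℂ) * (-1) ^ ((i : ℤ) - M) / ((i : ℂ) - M) =
      ∑ i ∈ Finset.range (p + 1),
        (if M < i then (p.choose i : ℂ) * (-1) ^ (i - M) / ((i : ℂ) - M) else 0) -
      ∑ j ∈ Finset.range (p + 1),
        (if p - M < p + 1 - 1 - j then (p.choose (p + 1 - 1 - j) : ℂ) *
          (-1) ^ (p + 1 - 1 - j - (p - M)) /
            (((p + 1 - 1 - j : ℕ) : ℂ) - ((p - M : ℕ) : ℂ)) else 0) := by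
    rw [← Finset.sum_sub_distrib]
    refine Finset.sum_congr rfl fun i hi => ?_
    have hi' : i ≤ p := by have := Finset.mem_range.mp hi; omega
    rcases lt_trichotomy M i with h | h | h
    · rw [if_pos h, if_neg (by omega), sub_zero, ← Nat.cast_sub h.le, zpow_natCast]
    · subst h
      simp
    · rw [if_neg (by omega), if_pos (by omega), Nat.add_sub_cancel, Nat.choose_symm hi',
        show p - i - (p - M) = M - i by omega, show (i : ℤ) - M = -((M - i : ℕ) : ℤ) by omega,
        zpow_neg, zpow_natCast, ← inv_pow, Nat.cast_sub hi', Nat.cast_sub hM]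
      have : ((-1 : ℂ))⁻¹ = -1 := by norm_num
      rw [this, show (p : ℂ) - i - (p - M) = -((i : ℂ) - M) by ring, div_neg]
      ring
  rw [h3, h1, h2, Nat.choose_symm hM]
  ring

/-- The Beta integral ∫₀¹ x^{d-1} (1-x)^n dx expanded termwise; Pascal's rule gives the recursion
S(n+1, d) = S(n, d) - S(n, d+1) without integration. -/
theorem sum_choose_neg_one_pow_div_add (n d : ℕ) (hd : 0 < d) :
    ∑ k ∈ Finset.range (n + 1), (n.choose k : ℂ) * (-1) ^ k / ((d : ℂ) + k) =
      ((d - 1).factorial * n.factorial : ℂ) / (n + d).factorial := by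
  induction n generalizing d with
  | zero =>
    obtain ⟨e, rfl⟩ : ∃ e, d = e + 1 := ⟨d - 1, by omega⟩
    have h1 : (e.factorial : ℂ) ≠ 0 := Nat.cast_ne_zero.mpr e.factorial_ne_zero
    simp [Nat.factorial_succ]
    field_simp
  | succ n ih =>
    have h1 : ∑ k ∈ Finset.range (n + 1 + 1), ((n + 1).choose k : ℂ) * (-1) ^ k / ((d : ℂ) + k) =
        ∑ k ∈ Finset.range (n + 1), (n.choose k : ℂ) * (-1) ^ k / ((d : ℂ) + k) -
        ∑ k ∈ Finset.range (n + 1), (n.choose k : ℂ) * (-1) ^ k / (((d + 1 : ℕ) : ℂ) + k) := by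
      have h2 : ∑ k ∈ Finset.range (n + 1), (n.choose k : ℂ) * (-1) ^ k / ((d : ℂ) + k) =
          ∑ k ∈ Finset.range (n + 1 + 1), (n.choose k : ℂ) * (-1) ^ k / ((d : ℂ) + k) := by
        rw [Finset.sum_range_succ _ (n + 1)]
        simp
      rw [h2, Finset.sum_range_succ' _ (n + 1),
        Finset.sum_range_succ' _ (n + 1), add_sub_right_comm,
        ← Finset.sum_sub_distrib]
      congr 1
      · refine Finset.sum_congr rfl fun k _ => ?_
        rw [Nat.choose_succ_succ]
        push_cast
        rw [show (d : ℂ) + 1 + k = d + (k + 1) by ring]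
        ring
      · simp
    rw [h1, ih d hd, ih (d + 1) (by omega)]
    obtain ⟨e, rfl⟩ : ∃ e, d = e + 1 := ⟨d - 1, by omega⟩
    simp only [Nat.add_sub_cancel]
    rw [show n + (e + 1 + 1) = (n + e + 1) + 1 by ring, show n + (e + 1) = n + e + 1 by ring,
      show n + 1 + (e + 1) = (n + e + 1) + 1 by ring, Nat.factorial_succ (n + e + 1),
      Nat.factorial_succ e, Nat.factorial_succ n]
    have h2 : ((n + e + 1).factorial : ℂ) ≠ 0 := Nat.cast_ne_zero.mpr (Nat.factorial_ne_zero _)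
    have h3 : ((n : ℂ) + e + 1 + 1) ≠ 0 := by exact_mod_cast Nat.succ_ne_zero (n + e + 1)
    push_cast
    field_simp
    ring

/-! ### The sums Φ and their expansion at ε. -/

/-- The sum over `j ≠ N` of `f_j (-a) ^ (j - N) / (j - N)`, where the `f_j` are the Taylor
coefficients at `z` of `(X² - 1) ^ n`; the term `j = N` vanishes by the convention `x / 0 = 0`. -/
noncomputable def legendrePhi (n N : ℕ) (z a : ℂ) : ℂ :=
  ∑ j ∈ Finset.range (2 * n + 1),
    legendreTaylor n j z * (-a) ^ ((j : ℤ) - N) / ((j : ℂ) - N)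

/-- The part `j > M` of the sum `legendrePhi`. -/
noncomputable def legendrePhiUpper (n M : ℕ) (z a : ℂ) : ℂ :=
  ∑ j ∈ Finset.range (2 * n + 1),
    if M < j then legendreTaylor n j z * (-a) ^ (j - M) / ((j : ℂ) - M) else 0

/-- The part `j < N` of the sum `legendrePhi`. -/
noncomputable def legendrePhiLower (n N : ℕ) (z a : ℂ) : ℂ :=
  ∑ j ∈ Finset.range (2 * n + 1),
    if j < N then legendreTaylor n j z * (-a) ^ ((j : ℤ) - N) / ((j : ℂ) - N) else 0

theorem legendrePhi_eq_add (n N : ℕ) (z a : ℂ) :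
    legendrePhi n N z a = legendrePhiLower n N z a + legendrePhiUpper n N z a := by
  rw [legendrePhi, legendrePhiLower, legendrePhiUpper, ← Finset.sum_add_distrib]
  refine Finset.sum_congr rfl fun j _ => ?_
  rcases lt_trichotomy N j with h | h | h
  · rw [if_neg (by omega), if_pos h, zero_add, ← Nat.cast_sub h.le, zpow_natCast]
  · subst h
    simp
  · rw [if_pos h, if_neg (by omega), add_zero]

/-- The index change j = 2n - i replaces order n + m by n - m and a by b = (z² - 1)/a, and reverses
the sign of the denominator. Hence the part j < n + m at a corresponds to the part i > n - m at b.
-/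
theorem legendreTaylor_reflect_term (n m i : ℕ) (hmn : m ≤ n) (hi : i ≤ 2 * n) (z a b : ℂ)
    (ha : a ≠ 0) (hb : b ≠ 0) (hab : a * b = z ^ 2 - 1) :
    legendreTaylor n (2 * n - i) z * (-a) ^ (((2 * n - i : ℕ) : ℤ) - ((n + m : ℕ) : ℤ)) /
        (((2 * n - i : ℕ) : ℂ) - ((n + m : ℕ) : ℂ)) =
      -((z ^ 2 - 1) ^ m)⁻¹ * (legendreTaylor n i z * (-b) ^ ((i : ℤ) - ((n - m : ℕ) : ℤ)) /
        ((i : ℂ) - ((n - m : ℕ) : ℂ))) := by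
  have hr := legendreTaylor_reflect n i hi z
  rw [← hab] at hr ⊢
  have hc : a * b ≠ 0 := mul_ne_zero ha hb
  have e1 : legendreTaylor n (2 * n - i) z =
      legendreTaylor n i z * (a * b) ^ ((i : ℤ) - (n : ℤ)) := by
    rw [zpow_sub₀ hc, zpow_natCast, zpow_natCast, mul_div_assoc', hr,
      mul_div_cancel_left₀ _ (pow_ne_zero _ hc)]
  have e2 : (a * b) ^ ((i : ℤ) - (n : ℤ)) *
      (-a) ^ (((2 * n - i : ℕ) : ℤ) - ((n + m : ℕ) : ℤ)) =
      ((a * b) ^ m)⁻¹ * (-b) ^ ((i : ℤ) - ((n - m : ℕ) : ℤ)) := by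
    rw [show a * b = (-a) * (-b) by ring, mul_zpow, mul_pow, mul_inv]
    have ha' := neg_ne_zero.mpr ha
    have hb' := neg_ne_zero.mpr hb
    rw [← zpow_natCast (-a) m, ← zpow_natCast (-b) m, ← zpow_neg, ← zpow_neg,
      show (i : ℤ) - ((n - m : ℕ) : ℤ) = m + (i - n) by omega, zpow_add₀ hb',
      show ((2 * n - i : ℕ) : ℤ) - ((n + m : ℕ) : ℤ) = -(i - n : ℤ) + -(m : ℤ) by omega,
      zpow_add₀ ha']
    rw [zpow_neg (-a) (i - n : ℤ), zpow_neg (-b)]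
    have h1 : (-a) ^ ((i : ℤ) - n) ≠ 0 := zpow_ne_zero _ ha'
    have h2 : (-b) ^ (m : ℤ) ≠ 0 := zpow_ne_zero _ hb'
    field_simp
  have e3 : (((2 * n - i : ℕ) : ℂ) - ((n + m : ℕ) : ℂ)) = -((i : ℂ) - ((n - m : ℕ) : ℂ)) := by
    rw [Nat.cast_sub hi, Nat.cast_sub hmn]
    push_cast
    ring
  rw [e1, e3, mul_assoc, e2, div_neg]
  ring

theorem legendrePhi_reflect (n m : ℕ) (hmn : m ≤ n) (z a b : ℂ)
    (ha : a ≠ 0) (hb : b ≠ 0) (hab : a * b = z ^ 2 - 1) :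
    legendrePhi n (n + m) z a = -((z ^ 2 - 1) ^ m)⁻¹ * legendrePhi n (n - m) z b := by
  rw [legendrePhi, ← Finset.sum_range_reflect, legendrePhi, Finset.mul_sum]
  refine Finset.sum_congr rfl fun i hi => ?_
  rw [Nat.add_sub_cancel]
  exact legendreTaylor_reflect_term n m i hmn (by have := Finset.mem_range.mp hi; omega) z a b
    ha hb hab

theorem legendrePhiLower_reflect (n m : ℕ) (hmn : m ≤ n) (z a b : ℂ)
    (ha : a ≠ 0) (hb : b ≠ 0) (hab : a * b = z ^ 2 - 1) :
    legendrePhiLower n (n + m) z a =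
      -((z ^ 2 - 1) ^ m)⁻¹ * legendrePhiUpper n (n - m) z b := by
  rw [legendrePhiLower, ← Finset.sum_range_reflect, legendrePhiUpper, Finset.mul_sum]
  refine Finset.sum_congr rfl fun i hi => ?_
  have hi' : i ≤ 2 * n := by have := Finset.mem_range.mp hi; omega
  rw [Nat.add_sub_cancel]
  by_cases h : n - m < i
  · rw [if_pos (by omega), if_pos h, legendreTaylor_reflect_term n m i hmn hi' z a b ha hb hab,
      ← Nat.cast_sub h.le, zpow_natCast]
  · rw [if_neg (by omega), if_neg h, mul_zero]

theorem legendreTaylor_reflect_mid (n m : ℕ) (hmn : m ≤ n) (z : ℂ) (hc : z ^ 2 - 1 ≠ 0) :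
    legendreTaylor n (n + m) z = ((z ^ 2 - 1) ^ m)⁻¹ * legendreTaylor n (n - m) z := by
  have h := legendreTaylor_reflect n (n + m) (by omega) z
  rw [show 2 * n - (n + m) = n - m by omega, pow_add] at h
  have h1 : (z ^ 2 - 1) ^ n ≠ 0 := pow_ne_zero _ hc
  have h2 : (z ^ 2 - 1) ^ m ≠ 0 := pow_ne_zero _ hc
  field_simp
  exact mul_left_cancel₀ h1 (by linear_combination h)

theorem legendrePhiUpper_eq_sum (n M : ℕ) (z a ε : ℂ) (hε : ε ^ 2 = 1) :
    legendrePhiUpper n M z a = ∑ k ∈ Finset.range (n + 1), (n.choose k * (2 * ε) ^ (n - k)) *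
      (∑ Q ∈ Finset.range (n + k), (Q.choose M : ℂ) * (z - ε - a) ^ (n + k - Q) *
          (z - ε) ^ (Q - M) / (((n + k : ℕ) : ℂ) - Q) +
        (n + k).choose M * ((harmonic M : ℂ) - harmonic (n + k)) * (z - ε) ^ (n + k - M)) := by
  have h1 : legendrePhiUpper n M z a = ∑ j ∈ Finset.range (2 * n + 1),
      ∑ k ∈ Finset.range (n + 1), (n.choose k * (2 * ε) ^ (n - k)) *
        (if M < j then ((n + k).choose j : ℂ) * (z - ε) ^ (n + k - j) * (-a) ^ (j - M) /
          ((j : ℂ) - M) else 0) := by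
    refine Finset.sum_congr rfl fun j _ => ?_
    split_ifs with h
    · rw [legendreTaylor_eq_sum n j z ε hε, Finset.sum_mul, Finset.sum_div]
      refine Finset.sum_congr rfl fun k _ => ?_
      ring
    · simp
  rw [h1, Finset.sum_comm]
  refine Finset.sum_congr rfl fun k hk => ?_
  have hk' : k ≤ n := by have := Finset.mem_range.mp hk; omega
  rw [← Finset.mul_sum, show z - ε - a = z - ε + -a by ring, ← sum_choose_mul_pow_div]
  congr 1
  symm
  refine Finset.sum_subset (Finset.range_mono (by omega)) fun i _ hi => ?_
  rw [Finset.mem_range, not_lt] at hi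
  rw [Nat.choose_eq_zero_of_lt (by omega)]
  simp

/-- At a = z - ε the powers of z - ε in the k-th block combine to the exponent n + k - M,
independent of j, so the sum over j is purely numerical. -/
theorem legendrePhi_eq_sum (n M : ℕ) (hM : M ≤ n) (z ε : ℂ) (hε : ε ^ 2 = 1)
    (hz : z - ε ≠ 0) :
    legendrePhi n M z (z - ε) = ∑ k ∈ Finset.range (n + 1),
      (n.choose k * (2 * ε) ^ (n - k)) * ((n + k).choose M *
        ((harmonic M : ℂ) - harmonic (n + k - M)) * (z - ε) ^ (n + k - M)) := by
  have h1 : legendrePhi n M z (z - ε) = ∑ j ∈ Finset.range (2 * n + 1),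
      ∑ k ∈ Finset.range (n + 1), (n.choose k * (2 * ε) ^ (n - k)) * (z - ε) ^ (n + k - M) *
        (((n + k).choose j : ℂ) * (-1) ^ ((j : ℤ) - M) / ((j : ℂ) - M)) := by
    refine Finset.sum_congr rfl fun j _ => ?_
    rw [legendreTaylor_eq_sum n j z ε hε, Finset.sum_mul, Finset.sum_div]
    refine Finset.sum_congr rfl fun k _ => ?_
    by_cases hj : j ≤ n + k
    · have e : (z - ε) ^ (n + k - j) * (-(z - ε)) ^ ((j : ℤ) - M) =
          (-1) ^ ((j : ℤ) - M) * (z - ε) ^ (n + k - M) := by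
        rw [neg_eq_neg_one_mul, mul_zpow, mul_left_comm, ← zpow_natCast, ← zpow_natCast,
          ← zpow_add₀ hz]
        congr 2
        omega
      linear_combination (n.choose k * (2 * ε) ^ (n - k)) * ((n + k).choose j : ℂ) *
        ((j : ℂ) - M)⁻¹ * e
    · rw [Nat.choose_eq_zero_of_lt (not_le.mp hj)]
      simp
  rw [h1, Finset.sum_comm]
  refine Finset.sum_congr rfl fun k hk => ?_
  have hk' : k ≤ n := by have := Finset.mem_range.mp hk; omega
  have h2 : ∑ j ∈ Finset.range (2 * n + 1),
      ((n + k).choose j : ℂ) * (-1) ^ ((j : ℤ) - M) / ((j : ℂ) - M) =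
      ∑ j ∈ Finset.range (n + k + 1),
      ((n + k).choose j : ℂ) * (-1) ^ ((j : ℤ) - M) / ((j : ℂ) - M) := by
    symm
    refine Finset.sum_subset (Finset.range_mono (by omega)) fun i _ hi => ?_
    rw [Finset.mem_range, not_lt] at hi
    rw [Nat.choose_eq_zero_of_lt (by omega)]
    simp
  rw [← Finset.mul_sum, h2, sum_choose_neg_one_zpow_div (n + k) M (by omega)]
  ring

/-- After exchanging the sums, the coefficient of y^{Q-M} is a sum over k > Q - n. For Q < n all k
occur and the sum is of Beta type; for Q = n + κ only k > κ occur and harmonic numbers appear. -/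
theorem sum_choose_sum_choose (n M : ℕ) (y ε : ℂ) :
    ∑ k ∈ Finset.range (n + 1), (n.choose k * (2 * ε) ^ (n - k)) *
      ∑ Q ∈ Finset.range (n + k), (Q.choose M : ℂ) * (-(2 * ε)) ^ (n + k - Q) *
          y ^ (Q - M) / (((n + k : ℕ) : ℂ) - Q) =
    ∑ Q ∈ Finset.range n, (Q.choose M : ℂ) * (2 * ε) ^ (2 * n - Q) * y ^ (Q - M) *
      ((-1) ^ (n - Q) * (((n - Q - 1).factorial * n.factorial : ℂ) / (2 * n - Q).factorial)) +
    ∑ k ∈ Finset.range (n + 1), (n.choose k * (2 * ε) ^ (n - k)) *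
      ((n + k).choose M * y ^ (n + k - M) * ((harmonic k : ℂ) - harmonic n)) := by
  have h1 : ∀ k ∈ Finset.range (n + 1), (n.choose k * (2 * ε) ^ (n - k)) *
      ∑ Q ∈ Finset.range (n + k), (Q.choose M : ℂ) * (-(2 * ε)) ^ (n + k - Q) *
          y ^ (Q - M) / (((n + k : ℕ) : ℂ) - Q) =
      ∑ Q ∈ Finset.range (2 * n + 1), if Q < n + k then
        (Q.choose M : ℂ) * (2 * ε) ^ (2 * n - Q) * y ^ (Q - M) *
          ((n.choose k : ℂ) * (-1) ^ (n + k - Q) / (((n + k : ℕ) : ℂ) - Q)) else 0 := by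
    intro k hk
    have hk' : k ≤ n := by have := Finset.mem_range.mp hk; omega
    rw [← Finset.sum_filter, Finset.mul_sum]
    have : (Finset.range (2 * n + 1)).filter (fun Q => Q < n + k) = Finset.range (n + k) := by
      ext Q
      simp only [Finset.mem_filter, Finset.mem_range]
      omega
    rw [this]
    refine Finset.sum_congr rfl fun Q hQ => ?_
    have hQ' := Finset.mem_range.mp hQ
    rw [show 2 * n - Q = (n - k) + (n + k - Q) by omega, pow_add, neg_pow (2 * ε)]
    ring
  rw [Finset.sum_congr rfl h1, Finset.sum_comm, show 2 * n + 1 = n + (n + 1) by ring,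
    Finset.sum_range_add]
  congr 1
  · refine Finset.sum_congr rfl fun Q hQ => ?_
    have hQ' := Finset.mem_range.mp hQ
    have h2 := sum_choose_neg_one_pow_div_add n (n - Q) (by omega)
    rw [show n + (n - Q) = 2 * n - Q by omega] at h2
    rw [← h2, Finset.mul_sum, Finset.mul_sum]
    refine Finset.sum_congr rfl fun k _ => ?_
    rw [if_pos (by omega), show n + k - Q = (n - Q) + k by omega, pow_add,
      Nat.cast_sub hQ'.le]
    push_cast
    rw [show (n : ℂ) + k - Q = n - Q + k by ring]
    ring
  · refine Finset.sum_congr rfl fun κ hκ => ?_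
    have h2 := sum_choose_neg_one_pow_div n κ
    have h3 : ∀ k ∈ Finset.range (n + 1), (if n + κ < n + k then
        ((n + κ).choose M : ℂ) * (2 * ε) ^ (2 * n - (n + κ)) * y ^ (n + κ - M) *
          ((n.choose k : ℂ) * (-1) ^ (n + k - (n + κ)) / (((n + k : ℕ) : ℂ) - (n + κ : ℕ)))
          else 0) = ((n + κ).choose M : ℂ) * (2 * ε) ^ (n - κ) * y ^ (n + κ - M) *
          (if κ < k then (n.choose k : ℂ) * (-1) ^ (k - κ) / ((k : ℂ) - κ) else 0) := by
      intro k _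
      by_cases h : κ < k
      · rw [if_pos (by omega), if_pos h, show 2 * n - (n + κ) = n - κ by omega,
          show n + k - (n + κ) = k - κ by omega]
        push_cast
        rw [add_sub_add_left_eq_sub]
      · rw [if_neg (by omega), if_neg h, mul_zero]
    rw [Finset.sum_congr rfl h3, ← Finset.mul_sum, h2]
    ring

/-- The rational part of the Legendre function of the second kind, expanded at `ε`. -/
theorem legendrePhi_sub_eq_sum (n m : ℕ) (hmn : m ≤ n) (z ε : ℂ) (hε : ε ^ 2 = 1)
    (hy : z - ε ≠ 0) (hw : z + ε ≠ 0) :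
    legendrePhi n (n + m) z (z + ε) - legendrePhi n (n + m) z (z - ε) =
      ∑ k ∈ Finset.range (n + 1), (n.choose k * (2 * ε) ^ (n - k)) *
        ((n + k).choose (n + m) * ((harmonic (n + k) : ℂ) - harmonic (n + m)) *
          (z - ε) ^ (n + k - (n + m))) +
      ((z ^ 2 - 1) ^ m)⁻¹ * ∑ Q ∈ Finset.range n,
        (Q.choose (n - m) : ℂ) * (2 * ε) ^ (2 * n - Q) * (z - ε) ^ (Q - (n - m)) *
        ((-1) ^ (n - Q) * (((n - Q - 1).factorial * n.factorial : ℂ) /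
          (2 * n - Q).factorial)) +
      ((z ^ 2 - 1) ^ m)⁻¹ * ∑ k ∈ Finset.range (n + 1), (n.choose k * (2 * ε) ^ (n - k)) *
        ((n + k).choose (n - m) * (z - ε) ^ (n + k - (n - m)) *
          ((harmonic (m + k) : ℂ) + harmonic k - harmonic (n + k))) -
      harmonic n * legendreTaylor n (n + m) z := by
  have hc : (z + ε) * (z - ε) = z ^ 2 - 1 := by linear_combination -hε
  have hc0 : z ^ 2 - 1 ≠ 0 := hc ▸ mul_ne_zero hw hy
  -- The reflections are applied to all of Φ at z + ε but only to the lower half at z - ε. What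
  -- remains is a full sum at z - ε and two upper halves, exactly the sums evaluated above.
  rw [legendrePhi_eq_add n (n + m) z (z - ε), legendrePhi_reflect n m hmn z _ _ hw hy hc,
    legendrePhiLower_reflect n m hmn z _ _ hy hw (by rw [mul_comm, hc]),
    legendrePhi_eq_sum n (n - m) (by omega) z ε hε hy,
    legendrePhiUpper_eq_sum n (n + m) z (z - ε) ε hε,
    legendrePhiUpper_eq_sum n (n - m) z (z + ε) ε hε,
    legendreTaylor_reflect_mid n m hmn z hc0, legendreTaylor_eq_sum n (n - m) z ε hε]
  simp only [mul_add, Finset.sum_add_distrib, show z - ε - (z + ε) = -(2 * ε) by ring]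
  rw [sum_choose_sum_choose]
  -- For a = z - ε the base x + v is zero, so only the harmonic terms survive.
  have h0 : ∑ k ∈ Finset.range (n + 1), ((n.choose k : ℂ) * (2 * ε) ^ (n - k)) *
      ∑ Q ∈ Finset.range (n + k), (Q.choose (n + m) : ℂ) * (z - ε - (z - ε)) ^ (n + k - Q) *
          (z - ε) ^ (Q - (n + m)) / (((n + k : ℕ) : ℂ) - Q) = 0 := by
    refine Finset.sum_eq_zero fun k _ => ?_
    rw [Finset.sum_eq_zero, mul_zero]
    intro Q hQ
    have := Finset.mem_range.mp hQ
    rw [sub_self, zero_pow (by omega)]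
    simp
  rw [h0, zero_add]
  have e1 : ∀ k, n + k - (n - m) = m + k := fun k => by omega
  simp only [e1]
  have h1 : ∑ k ∈ Finset.range (n + 1), (n.choose k * (2 * ε) ^ (n - k)) *
      ((n + k).choose (n + m) * ((harmonic (n + m) : ℂ) - harmonic (n + k)) *
        (z - ε) ^ (n + k - (n + m))) = -∑ k ∈ Finset.range (n + 1),
      (n.choose k * (2 * ε) ^ (n - k)) * ((n + k).choose (n + m) *
        ((harmonic (n + k) : ℂ) - harmonic (n + m)) * (z - ε) ^ (n + k - (n + m))) := by
    rw [← Finset.sum_neg_distrib]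
    exact Finset.sum_congr rfl fun k _ => by ring
  -- H_{n-m} cancels between the first and third sums, and -H_n factors out as a multiple of
  -- f_{n-m}.
  have h2 : -∑ k ∈ Finset.range (n + 1), (n.choose k * (2 * ε) ^ (n - k)) *
        ((n + k).choose (n - m) * ((harmonic (n - m) : ℂ) - harmonic (m + k)) *
          (z - ε) ^ (m + k)) +
      (∑ k ∈ Finset.range (n + 1), (n.choose k * (2 * ε) ^ (n - k)) *
        ((n + k).choose (n - m) * (z - ε) ^ (m + k) * ((harmonic k : ℂ) - harmonic n)) +
      ∑ k ∈ Finset.range (n + 1), (n.choose k * (2 * ε) ^ (n - k)) *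
        ((n + k).choose (n - m) * ((harmonic (n - m) : ℂ) - harmonic (n + k)) *
          (z - ε) ^ (m + k))) =
      ∑ k ∈ Finset.range (n + 1), (n.choose k * (2 * ε) ^ (n - k)) *
        ((n + k).choose (n - m) * (z - ε) ^ (m + k) *
          ((harmonic (m + k) : ℂ) + harmonic k - harmonic (n + k))) -
      harmonic n * ∑ k ∈ Finset.range (n + 1), (n.choose k * (2 * ε) ^ (n - k)) *
        ((n + k).choose (n - m) * (z - ε) ^ (m + k)) := by
    rw [← Finset.sum_neg_distrib, ← Finset.sum_add_distrib, ← Finset.sum_add_distrib,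
      Finset.mul_sum, ← Finset.sum_sub_distrib]
    exact Finset.sum_congr rfl fun k _ => by ring
  linear_combination -h1 + ((z ^ 2 - 1) ^ m)⁻¹ * h2

/-! ### Contour integrals with logarithms. -/

theorem hasDerivAt_circleIntegral_exp_mul {c : ℂ} {R : ℝ} (hR : 0 ≤ R) {g h : ℂ → ℂ}
    (hg : ContinuousOn g (Metric.sphere c R)) (hh : ContinuousOn h (Metric.sphere c R)) (ν₀ : ℂ) :
    HasDerivAt (fun ν => circleIntegral (fun t => Complex.exp (ν * g t) * h t) c R)
      (circleIntegral (fun t => g t * (Complex.exp (ν₀ * g t) * h t)) c R) ν₀ := by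
  have hmem : ∀ θ, circleMap c R θ ∈ Metric.sphere c R := circleMap_mem_sphere c hR
  have hcg : Continuous fun θ => g (circleMap c R θ) :=
    hg.comp_continuous (continuous_circleMap c R) hmem
  have hch : Continuous fun θ => h (circleMap c R θ) :=
    hh.comp_continuous (continuous_circleMap c R) hmem
  have hcd : Continuous fun θ => deriv (circleMap c R) θ := by
    simp only [deriv_circleMap]
    fun_prop
  obtain ⟨A, hA⟩ := (isCompact_sphere c R).exists_bound_of_continuousOn hg
  obtain ⟨B, hB⟩ := (isCompact_sphere c R).exists_bound_of_continuousOn hh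
  have hA0 : 0 ≤ A := (norm_nonneg _).trans (hA _ (hmem 0))
  have hB0 : 0 ≤ B := (norm_nonneg _).trans (hB _ (hmem 0))
  refine (intervalIntegral.hasDerivAt_integral_of_dominated_loc_of_deriv_le
    (F := fun ν θ => deriv (circleMap c R) θ • (Complex.exp (ν * g (circleMap c R θ)) *
      h (circleMap c R θ)))
    (F' := fun ν θ => deriv (circleMap c R) θ • (g (circleMap c R θ) *
      (Complex.exp (ν * g (circleMap c R θ)) * h (circleMap c R θ))))
    (bound := fun _ => R * (A * (Real.exp ((‖ν₀‖ + 1) * A) * B)))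
    (Metric.ball_mem_nhds ν₀ one_pos) ?_ ?_ ?_ ?_ ?_ ?_).2
  · exact Filter.Eventually.of_forall fun ν => by
      exact (hcd.smul ((continuous_const.mul hcg).cexp.mul hch)).aestronglyMeasurable
  · exact (hcd.smul ((continuous_const.mul hcg).cexp.mul hch)).intervalIntegrable _ _
  · exact (hcd.smul (hcg.mul ((continuous_const.mul hcg).cexp.mul hch))).aestronglyMeasurable
  · refine Filter.Eventually.of_forall fun θ _ ν hν => ?_
    have hν' : ‖ν‖ ≤ ‖ν₀‖ + 1 := by
      have h1 : ‖ν - ν₀‖ < 1 := by rwa [← dist_eq_norm]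
      have h2 := norm_le_norm_add_norm_sub' ν ν₀
      linarith
    have h3 : ‖Complex.exp (ν * g (circleMap c R θ))‖ ≤ Real.exp ((‖ν₀‖ + 1) * A) := by
      refine (Complex.norm_exp_le_exp_norm _).trans (Real.exp_le_exp.mpr ?_)
      rw [norm_mul]
      exact mul_le_mul hν' (hA _ (hmem θ)) (norm_nonneg _) (by positivity)
    have h4 : ‖deriv (circleMap c R) θ‖ = R := by simp [abs_of_nonneg hR]
    rw [norm_smul, norm_mul, norm_mul, h4]
    have h5 := hA _ (hmem θ)
    have h6 := hB _ (hmem θ)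
    gcongr
  · exact intervalIntegrable_const
  · refine Filter.Eventually.of_forall fun θ _ ν _ => ?_
    have h1 : HasDerivAt (fun ν : ℂ => Complex.exp (ν * g (circleMap c R θ)))
        (Complex.exp (ν * g (circleMap c R θ)) * (1 * g (circleMap c R θ))) ν :=
      ((hasDerivAt_id ν).mul_const _).cexp
    refine ((h1.mul_const (h (circleMap c R θ))).const_smul
      (deriv (circleMap c R) θ)).congr_deriv ?_
    simp only [smul_eq_mul]
    ring

/-- If the quotient were -r with r ≥ 0, then t = (a + r b)/(1 + r) would lie on the segment from a
to b, hence in the ball by convexity. -/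
theorem sub_div_sub_mem_slitPlane {c a b t : ℂ} {R : ℝ} (ha : a ∈ Metric.ball c R)
    (hb : b ∈ Metric.ball c R) (ht : t ∉ Metric.ball c R) :
    (t - a) / (t - b) ∈ Complex.slitPlane := by
  by_contra hcon
  rw [Complex.mem_slitPlane_iff] at hcon
  push Not at hcon
  obtain ⟨h1, h2⟩ := hcon
  have htb : t - b ≠ 0 := sub_ne_zero.mpr fun h => ht (h ▸ hb)
  set r : ℝ := -((t - a) / (t - b)).re with hr
  have hr0 : 0 ≤ r := by linarith
  have hq : (t - a) / (t - b) = -(r : ℂ) := by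
    apply Complex.ext <;> simp [hr, h2]
  rw [div_eq_iff htb] at hq
  have hr1 : (1 + (r : ℂ)) ≠ 0 := by
    have : (1 + r) ≠ 0 := by positivity
    exact_mod_cast this
  apply ht
  have hconv := convex_ball c R ha hb (show 0 ≤ 1 / (1 + r) by positivity)
    (show 0 ≤ r / (1 + r) by positivity) (by field_simp)
  convert hconv using 1
  simp only [Complex.real_smul]
  push_cast
  field_simp
  linear_combination hq

/-- The circle may be enlarged without changing the integral, and on a circle of radius R' the decay
makes the integrand at most e/(2πR'). -/
theorem circleIntegral_eq_zero_of_tendsto_cobounded {c : ℂ} {R : ℝ} (hR : 0 < R) {h : ℂ → ℂ}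
    (hd : ∀ t ∉ Metric.ball c R, DifferentiableAt ℂ h t)
    (hlim : Filter.Tendsto (fun t => (t - c) * h t) (Bornology.cobounded ℂ) (nhds 0)) :
    circleIntegral h c R = 0 := by
  refine norm_le_zero_iff.mp (le_of_forall_pos_le_add fun e he => ?_)
  have hev : ∀ᶠ t in Bornology.cobounded ℂ, ‖(t - c) * h t‖ < e / (2 * Real.pi) := by
    have := (tendsto_zero_iff_norm_tendsto_zero.mp hlim).eventually_lt_const
      (show (0 : ℝ) < e / (2 * Real.pi) by positivity)
    exact this
  obtain ⟨r, -, hr⟩ := (Metric.hasBasis_cobounded_compl_closedBall c).eventually_iff.mp hev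
  set R' := max R (r + 1) with hR'
  have hR'0 : 0 < R' := lt_of_lt_of_le hR (le_max_left _ _)
  rw [← Complex.circleIntegral_eq_of_differentiable_on_annulus_off_countable hR
    (le_max_left R (r + 1)) Set.countable_empty
    (fun t ht => (hd t ht.2).continuousAt.continuousWithinAt)
    (fun t ht => hd t fun h => ht.1.2 (Metric.ball_subset_closedBall h)), zero_add]
  refine (circleIntegral.norm_integral_le_of_norm_le_const (C := e / (2 * Real.pi) / R')
    hR'0.le fun t ht => ?_).trans (le_of_eq ?_)
  · have h1 := hr (show t ∈ (Metric.closedBall c r)ᶜ by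
      rw [Set.mem_compl_iff, Metric.mem_closedBall, not_le, Metric.mem_sphere.mp ht]
      exact lt_of_lt_of_le (lt_add_one r) (le_max_right _ _))
    rw [norm_mul, ← dist_eq_norm, Metric.mem_sphere.mp ht] at h1
    rw [le_div_iff₀ hR'0, mul_comm]
    exact h1.le
  · field_simp

theorem tendsto_inv_sub_cobounded (a : ℂ) :
    Filter.Tendsto (fun t : ℂ => (t - a)⁻¹) (Bornology.cobounded ℂ) (nhds 0) :=
  Filter.tendsto_inv₀_cobounded.comp (tendsto_sub_const_cobounded a)

theorem tendsto_sub_mul_inv_sub_cobounded (a b : ℂ) :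
    Filter.Tendsto (fun t : ℂ => (t - a) * (t - b)⁻¹) (Bornology.cobounded ℂ) (nhds 1) := by
  have h := ((tendsto_inv_sub_cobounded b).const_mul (b - a)).const_add 1
  rw [mul_zero, add_zero] at h
  refine h.congr' ?_
  filter_upwards [Bornology.eventually_ne_cobounded b] with t ht
  have : t - b ≠ 0 := sub_ne_zero.mpr ht
  field_simp
  ring

/-- The logarithm of `(t - a) / (t - b)` is holomorphic outside a disc containing `a` and `b`. -/
theorem hasDerivAt_log_sub_div_sub {c a b t : ℂ} {R : ℝ} (ha : a ∈ Metric.ball c R)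
    (hb : b ∈ Metric.ball c R) (ht : t ∉ Metric.ball c R) :
    HasDerivAt (fun t => Complex.log ((t - a) / (t - b))) ((t - a)⁻¹ - (t - b)⁻¹) t := by
  have hta : t - a ≠ 0 := sub_ne_zero.mpr fun h => ht (h ▸ ha)
  have htb : t - b ≠ 0 := sub_ne_zero.mpr fun h => ht (h ▸ hb)
  have h := (((hasDerivAt_id t).sub_const a).div ((hasDerivAt_id t).sub_const b) htb).clog
    (sub_div_sub_mem_slitPlane ha hb ht)
  refine h.congr_deriv ?_
  simp only [id_eq, Pi.div_apply]
  field_simp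

/-- The logarithm tends to log 1 = 0 at infinity, so even one factor (t-b)⁻¹ suffices for the decay
criterion. -/
theorem circleIntegral_log_sub_div_sub_mul_inv_pow {c a b : ℂ} {R : ℝ} (ha : a ∈ Metric.ball c R)
    (hb : b ∈ Metric.ball c R) (q : ℕ) :
    circleIntegral (fun t => Complex.log ((t - a) / (t - b)) * ((t - b)⁻¹) ^ (q + 1)) c R = 0 := by
  have hR : 0 < R := Metric.pos_of_mem_ball ha
  refine circleIntegral_eq_zero_of_tendsto_cobounded hR (fun t ht => ?_) ?_
  · have htb : t - b ≠ 0 := sub_ne_zero.mpr fun h => ht (h ▸ hb)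
    exact (hasDerivAt_log_sub_div_sub ha hb ht).differentiableAt.mul
      (((differentiableAt_id.sub_const b).inv htb).pow _)
  · have h1 : Filter.Tendsto (fun t : ℂ => Complex.log ((t - a) / (t - b)))
        (Bornology.cobounded ℂ) (nhds 0) := by
      have h := (tendsto_sub_mul_inv_sub_cobounded a b).clog (by simp)
      rw [Complex.log_one] at h
      simpa only [div_eq_mul_inv] using h
    have h2 := (h1.mul (tendsto_sub_mul_inv_sub_cobounded c b)).mul
      ((tendsto_inv_sub_cobounded b).pow q)
    rw [zero_mul, zero_mul] at h2
    refine h2.congr fun t => ?_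
    ring

/-- Integration by parts removes the logarithm and leaves a Cauchy integral with pole at a. -/
theorem circleIntegral_log_sub_div_sub_mul_pow {c a b : ℂ} {R : ℝ} (ha : a ∈ Metric.ball c R)
    (hb : b ∈ Metric.ball c R) (p : ℕ) :
    circleIntegral (fun t => Complex.log ((t - a) / (t - b)) * (t - b) ^ p) c R =
      2 * Real.pi * Complex.I * (-((a - b) ^ (p + 1) / (p + 1))) := by
  have hR : 0 < R := Metric.pos_of_mem_ball ha
  have hs : ∀ t ∈ Metric.sphere c R, t ∉ Metric.ball c R := fun t ht h =>
    absurd (Metric.mem_ball.mp h) (by rw [Metric.mem_sphere.mp ht]; exact lt_irrefl R)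
  have hp : ((p : ℂ) + 1) ≠ 0 := Nat.cast_add_one_ne_zero p
  have hne : ∀ {x t : ℂ}, x ∈ Metric.ball c R → t ∈ Metric.sphere c R → t - x ≠ 0 :=
    fun hx ht => sub_ne_zero.mpr fun h => hs _ ht (h ▸ hx)
  have hlog : ContinuousOn (fun t => Complex.log ((t - a) / (t - b))) (Metric.sphere c R) :=
    fun t ht => (hasDerivAt_log_sub_div_sub ha hb (hs t ht)).continuousAt.continuousWithinAt
  have hinv : ∀ {x : ℂ}, x ∈ Metric.ball c R →
      ContinuousOn (fun t : ℂ => (t - x)⁻¹) (Metric.sphere c R) := fun hx =>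
    (continuousOn_id.sub continuousOn_const).inv₀ fun t ht => hne hx ht
  have hpow : ∀ k : ℕ, ContinuousOn (fun t : ℂ => (t - b) ^ k) (Metric.sphere c R) := fun k =>
    (continuousOn_id.sub continuousOn_const).pow k
  have h1 := circleIntegral.integral_eq_zero_of_hasDerivWithinAt hR.le
    (f := fun t => Complex.log ((t - a) / (t - b)) * ((t - b) ^ (p + 1) / ((p : ℂ) + 1)))
    (f' := fun t => Complex.log ((t - a) / (t - b)) * (t - b) ^ p +
      ((p : ℂ) + 1)⁻¹ * ((t - a)⁻¹ * (t - b) ^ (p + 1) - (t - b) ^ p)) (c := c)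
    (fun t ht => by
      have h2 := (((hasDerivAt_id t).sub_const b).pow (p + 1)).div_const ((p : ℂ) + 1)
      refine (((hasDerivAt_log_sub_div_sub ha hb (hs t ht)).mul h2).congr_deriv
        ?_).hasDerivWithinAt
      have h3 := hne hb ht
      have h4 := hne ha ht
      simp only [id_eq, Pi.pow_apply, Nat.add_sub_cancel]
      push_cast
      field_simp
      ring)
  have i1 : CircleIntegrable (fun t => Complex.log ((t - a) / (t - b)) * (t - b) ^ p) c R :=
    (hlog.mul (hpow p)).circleIntegrable hR.le
  have i2 : CircleIntegrable (fun t => (t - a)⁻¹ * (t - b) ^ (p + 1)) c R :=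
    ((hinv ha).mul (hpow (p + 1))).circleIntegrable hR.le
  have i3 : CircleIntegrable (fun t => (t - b) ^ p) c R := (hpow p).circleIntegrable hR.le
  have i4 : CircleIntegrable (fun t => ((p : ℂ) + 1)⁻¹ *
      ((t - a)⁻¹ * (t - b) ^ (p + 1) - (t - b) ^ p)) c R :=
    (continuousOn_const.mul (((hinv ha).mul (hpow (p + 1))).sub (hpow p))).circleIntegrable hR.le
  rw [circleIntegral.integral_add i1 i4, circleIntegral.integral_const_mul,
    circleIntegral.integral_sub i2 i3] at h1
  have h5 : circleIntegral (fun t => (t - a)⁻¹ * (t - b) ^ (p + 1)) c R =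
      2 * Real.pi * Complex.I * (a - b) ^ (p + 1) := by
    have := DifferentiableOn.circleIntegral_sub_inv_smul (f := fun t => (t - b) ^ (p + 1))
      (c := c) (R := R) (by fun_prop) ha
    simpa using this
  have h6 : circleIntegral (fun t => (t - b) ^ p) c R = 0 := by
    have := circleIntegral.integral_sub_zpow_of_ne (n := (p : ℤ)) (by omega) c b R
    simpa only [zpow_natCast] using this
  rw [h5, h6] at h1
  field_simp at h1 ⊢
  linear_combination h1

/-- Partial fractions lower the order of the pole at b by one; the pole a lies outside the circle.
-/
theorem circleIntegral_inv_sub_mul_inv_pow {c a b : ℂ} {R : ℝ} (ha : a ∉ Metric.closedBall c R)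
    (hb : b ∈ Metric.ball c R) (q : ℕ) :
    circleIntegral (fun t => (t - a)⁻¹ * ((t - b)⁻¹) ^ (q + 1)) c R =
      2 * Real.pi * Complex.I * ((-1) ^ q / (b - a) ^ (q + 1)) := by
  have hR : 0 < R := Metric.pos_of_mem_ball hb
  have hd : DifferentiableOn ℂ (fun t => (t - a)⁻¹) (Metric.closedBall c R) :=
    (differentiableOn_id.sub_const a).inv fun t ht => sub_ne_zero.mpr fun h => ha (h ▸ ht)
  have hab : b - a ≠ 0 := sub_ne_zero.mpr fun h =>
    ha (h ▸ Metric.ball_subset_closedBall hb)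
  induction q with
  | zero =>
    have h := DifferentiableOn.circleIntegral_sub_inv_smul hd hb
    simp only [smul_eq_mul] at h
    simp only [zero_add, pow_one, pow_zero, one_div, ← h]
    congr 1
    funext t
    ring
  | succ q ih =>
    have hne : ∀ t ∈ Metric.sphere c R, t - b ≠ 0 := fun t ht => sub_ne_zero.mpr fun h => by
      have h1 := Metric.mem_ball.mp (h ▸ hb)
      rw [Metric.mem_sphere.mp ht] at h1
      exact lt_irrefl _ h1
    have hi : ContinuousOn (fun t : ℂ => (t - b)⁻¹) (Metric.sphere c R) :=
      (continuousOn_id.sub continuousOn_const).inv₀ hne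
    have e : circleIntegral (fun t => (t - a)⁻¹ * ((t - b)⁻¹) ^ (q + 1 + 1)) c R =
        circleIntegral (fun t => (b - a)⁻¹ * (((t - b)⁻¹) ^ (q + 1 + 1) -
          (t - a)⁻¹ * ((t - b)⁻¹) ^ (q + 1))) c R := by
      refine circleIntegral.integral_congr hR.le fun t ht => ?_
      have h1 := hne t ht
      have h2 : t - a ≠ 0 := sub_ne_zero.mpr fun h =>
        ha (h ▸ Metric.sphere_subset_closedBall ht)
      simp only [inv_pow]
      field_simp
      ring
    have h3 : circleIntegral (fun t => ((t - b)⁻¹) ^ (q + 1 + 1)) c R = 0 := by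
      have := circleIntegral.integral_sub_zpow_of_ne (n := -((q + 2 : ℕ) : ℤ)) (by omega) c b R
      simpa only [zpow_neg, zpow_natCast, inv_pow] using this
    have i1 : CircleIntegrable (fun t => ((t - b)⁻¹) ^ (q + 1 + 1)) c R :=
      (hi.pow _).circleIntegrable hR.le
    have i2 : CircleIntegrable (fun t => (t - a)⁻¹ * ((t - b)⁻¹) ^ (q + 1)) c R :=
      ((hd.continuousOn.mono Metric.sphere_subset_closedBall).mul
        (hi.pow _)).circleIntegrable hR.le
    rw [e, circleIntegral.integral_const_mul, circleIntegral.integral_sub i1 i2, ih, h3]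
    field_simp
    ring

/-- Integration by parts turns the logarithm into (t+1)⁻¹, the preceding integral with a = -1. -/
theorem circleIntegral_log_mul_inv_pow {c b : ℂ} {R : ℝ} (hb : b ∈ Metric.ball c R)
    (hcut : ∀ t ∈ Metric.closedBall c R, t + 1 ∈ Complex.slitPlane) (q : ℕ) :
    circleIntegral (fun t => Complex.log ((t + 1) / 2) * ((t - b)⁻¹) ^ (q + 2)) c R =
      2 * Real.pi * Complex.I * ((-1) ^ q / (b + 1) ^ (q + 1) / (q + 1)) := by
  have hR : 0 < R := Metric.pos_of_mem_ball hb
  have hq : ((q : ℂ) + 1) ≠ 0 := Nat.cast_add_one_ne_zero q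
  have hne : ∀ t ∈ Metric.sphere c R, t - b ≠ 0 := fun t ht => sub_ne_zero.mpr fun h => by
    have h1 := Metric.mem_ball.mp (h ▸ hb)
    rw [Metric.mem_sphere.mp ht] at h1
    exact lt_irrefl _ h1
  have hi : ContinuousOn (fun t : ℂ => (t - b)⁻¹) (Metric.sphere c R) :=
    (continuousOn_id.sub continuousOn_const).inv₀ hne
  have hl : ∀ t ∈ Metric.closedBall c R,
      HasDerivAt (fun t : ℂ => Complex.log ((t + 1) / 2)) ((t + 1)⁻¹) t := fun t ht => by
    have h1 : (t + 1) / 2 ∈ Complex.slitPlane := by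
      have := hcut t ht
      rw [Complex.mem_slitPlane_iff] at this ⊢
      simpa using this
    refine ((((hasDerivAt_id t).add_const 1).div_const 2).clog h1).congr_deriv ?_
    have := Complex.slitPlane_ne_zero (hcut t ht)
    simp only [id_eq]
    field_simp
  have hi1 : ContinuousOn (fun t : ℂ => (t + 1)⁻¹) (Metric.sphere c R) :=
    (continuousOn_id.add continuousOn_const).inv₀ fun t ht =>
      Complex.slitPlane_ne_zero (hcut t (Metric.sphere_subset_closedBall ht))
  have hlc : ContinuousOn (fun t : ℂ => Complex.log ((t + 1) / 2)) (Metric.sphere c R) :=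
    fun t ht => (hl t (Metric.sphere_subset_closedBall ht)).continuousAt.continuousWithinAt
  have h1 := circleIntegral.integral_eq_zero_of_hasDerivWithinAt hR.le (c := c)
    (f := fun t => Complex.log ((t + 1) / 2) * (-(((t - b)⁻¹) ^ (q + 1) / ((q : ℂ) + 1))))
    (f' := fun t => Complex.log ((t + 1) / 2) * ((t - b)⁻¹) ^ (q + 2) -
      ((q : ℂ) + 1)⁻¹ * ((t - (-1))⁻¹ * ((t - b)⁻¹) ^ (q + 1)))
    (fun t ht => by
      have h2 := ((((hasDerivAt_id t).sub_const b).inv (hne t ht)).pow (q + 1)).div_const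
        ((q : ℂ) + 1)
      refine (((hl t (Metric.sphere_subset_closedBall ht)).mul h2.neg).congr_deriv
        ?_).hasDerivWithinAt
      have h3 := hne t ht
      have h4 := Complex.slitPlane_ne_zero (hcut t (Metric.sphere_subset_closedBall ht))
      simp only [id_eq, Pi.pow_apply, Pi.inv_apply, Nat.add_sub_cancel, sub_neg_eq_add, Pi.neg_apply]
      push_cast
      simp only [inv_pow]
      field_simp
      ring)
  simp only [sub_neg_eq_add] at h1
  have h5 := circleIntegral_inv_sub_mul_inv_pow (a := -1) (fun h => by
    have := Complex.slitPlane_ne_zero (hcut _ h)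
    simp at this) hb q
  simp only [sub_neg_eq_add] at h5
  have i1 : CircleIntegrable (fun t => Complex.log ((t + 1) / 2) * ((t - b)⁻¹) ^ (q + 2)) c R :=
    (hlc.mul (hi.pow _)).circleIntegrable hR.le
  have i2 : CircleIntegrable (fun t => ((q : ℂ) + 1)⁻¹ *
      ((t + 1)⁻¹ * ((t - b)⁻¹) ^ (q + 1))) c R :=
    (continuousOn_const.mul (hi1.mul (hi.pow _))).circleIntegrable hR.le
  rw [circleIntegral.integral_sub i1 i2, circleIntegral.integral_const_mul, h5] at h1
  rw [sub_eq_zero.mp h1]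
  ring

/-- These are the Taylor coefficients of log((t+1)/2) at z: order N - j ≥ 1, order 0, and none when
the integrand has no pole. -/
theorem circleIntegral_log_mul_zpow {c z : ℂ} {R : ℝ} (hz : z ∈ Metric.ball c R)
    (hcut : ∀ t ∈ Metric.closedBall c R, t + 1 ∈ Complex.slitPlane) (j N : ℕ) :
    circleIntegral (fun t => Complex.log ((t + 1) / 2) * (t - z) ^ ((j : ℤ) - N - 1)) c R =
      2 * Real.pi * Complex.I * (if j < N then (-(z + 1)) ^ ((j : ℤ) - N) / ((j : ℂ) - N) else
        if j = N then Complex.log ((z + 1) / 2) else 0) := by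
  have hd : DifferentiableOn ℂ (fun t : ℂ => Complex.log ((t + 1) / 2))
      (Metric.closedBall c R) := fun t ht => by
    have h1 : (t + 1) / 2 ∈ Complex.slitPlane := by
      have := hcut t ht
      rw [Complex.mem_slitPlane_iff] at this ⊢
      simpa using this
    have h2 : DifferentiableAt ℂ (fun t : ℂ => (t + 1) / 2) t := by fun_prop
    exact (h2.clog h1).differentiableWithinAt
  rcases lt_trichotomy j N with h | h | h
  · obtain ⟨q, rfl⟩ : ∃ q, N = j + q + 1 := ⟨N - j - 1, by omega⟩
    rw [if_pos h]
    have e := circleIntegral_log_mul_inv_pow hz hcut q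
    have e1 : ∀ t : ℂ, ((t - z)⁻¹) ^ (q + 2) = (t - z) ^ ((j : ℤ) - ((j + q + 1 : ℕ) : ℤ) - 1) := by
      intro t
      rw [show (j : ℤ) - ((j + q + 1 : ℕ) : ℤ) - 1 = -((q + 2 : ℕ) : ℤ) by omega, zpow_neg,
        zpow_natCast, inv_pow]
    simp only [e1] at e
    have e2 : (-1 : ℂ) ^ q * (-1) ^ q = 1 := by rw [← mul_pow]; simp
    have hq : ((q : ℂ) + 1) ≠ 0 := Nat.cast_add_one_ne_zero q
    have hz1 := Complex.slitPlane_ne_zero (hcut z (Metric.ball_subset_closedBall hz))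
    rw [e, show (j : ℤ) - ((j + q + 1 : ℕ) : ℤ) = -((q + 1 : ℕ) : ℤ) by omega, zpow_neg,
      zpow_natCast, neg_pow (z + 1), pow_succ (-1 : ℂ)]
    push_cast
    rw [show (j : ℂ) - (j + q + 1) = -(q + 1) by ring]
    have e3 : ((-1 : ℂ) ^ q) ≠ 0 := pow_ne_zero _ (by norm_num)
    field_simp
    linear_combination e2
  · subst h
    rw [if_neg (lt_irrefl _), if_pos rfl]
    have e := hd.circleIntegral_sub_inv_smul hz
    simp only [smul_eq_mul] at e
    rw [← e]
    congr 1
    funext t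
    rw [sub_self, zero_sub, zpow_neg_one, mul_comm]
  · rw [if_neg (by omega), if_neg (by omega), mul_zero]
    obtain ⟨p, rfl⟩ : ∃ p, j = N + p + 1 := ⟨j - N - 1, by omega⟩
    have e1 : ∀ t : ℂ, (t - z) ^ (((N + p + 1 : ℕ) : ℤ) - N - 1) = (t - z) ^ p := by
      intro t
      rw [show ((N + p + 1 : ℕ) : ℤ) - N - 1 = (p : ℤ) by omega, zpow_natCast]
    simp only [e1]
    refine DiffContOnCl.circleIntegral_eq_zero (Metric.pos_of_mem_ball hz).le ?_
    exact ((hd.mul ((differentiableOn_id.sub_const z).pow p)).mono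
      Metric.closure_ball_subset_closedBall).diffContOnCl

theorem circleIntegral_log_sub_div_sub_mul_zpow {c z : ℂ} {R : ℝ} (hz : z ∈ Metric.ball c R)
    (h1 : 1 ∈ Metric.ball c R) (j N : ℕ) :
    circleIntegral (fun t => Complex.log ((t - 1) / (t - z)) * (t - z) ^ ((j : ℤ) - N - 1)) c R =
      2 * Real.pi * Complex.I *
        (if N < j then -((-(z - 1)) ^ (j - N) / ((j : ℂ) - N)) else 0) := by
  by_cases h : N < j
  · rw [if_pos h]
    obtain ⟨p, rfl⟩ : ∃ p, j = N + p + 1 := ⟨j - N - 1, by omega⟩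
    have e1 : ∀ t : ℂ, (t - z) ^ (((N + p + 1 : ℕ) : ℤ) - N - 1) = (t - z) ^ p := by
      intro t
      rw [show ((N + p + 1 : ℕ) : ℤ) - N - 1 = (p : ℤ) by omega, zpow_natCast]
    simp only [e1]
    rw [circleIntegral_log_sub_div_sub_mul_pow h1 hz, show N + p + 1 - N = p + 1 by omega]
    push_cast
    rw [show (N : ℂ) + p + 1 - N = p + 1 by ring, neg_sub]
  · rw [if_neg h, mul_zero]
    obtain ⟨q, rfl⟩ : ∃ q, N = j + q := ⟨N - j, by omega⟩
    have e1 : ∀ t : ℂ, (t - z) ^ ((j : ℤ) - ((j + q : ℕ) : ℤ) - 1) = ((t - z)⁻¹) ^ (q + 1) := by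
      intro t
      rw [show (j : ℤ) - ((j + q : ℕ) : ℤ) - 1 = -((q + 1 : ℕ) : ℤ) by omega, zpow_neg,
        zpow_natCast, inv_pow]
    simp only [e1]
    exact circleIntegral_log_sub_div_sub_mul_inv_pow h1 hz q

/-! ### Value and degree derivative of P_ν^m at ν = n. -/

theorem sq_sub_one_pow_mul_zpow (n N : ℕ) {t z : ℂ} (h : t - z ≠ 0) :
    (t ^ 2 - 1) ^ n * (t - z) ^ (-(N : ℤ) - 1) = ∑ j ∈ Finset.range (2 * n + 1),
      legendreTaylor n j z * (t - z) ^ ((j : ℤ) - N - 1) := by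
  rw [← sum_legendreTaylor n z t, Finset.sum_mul]
  refine Finset.sum_congr rfl fun j _ => ?_
  rw [mul_assoc, ← zpow_natCast, ← zpow_add₀ h]
  congr 2
  ring

theorem circleIntegral_sq_sub_one_pow_mul_zpow {c z : ℂ} {R : ℝ} (hz : z ∈ Metric.ball c R)
    (n N : ℕ) (hN : N ≤ 2 * n) :
    circleIntegral (fun t => (t ^ 2 - 1) ^ n * (t - z) ^ (-(N : ℤ) - 1)) c R =
      2 * Real.pi * Complex.I * legendreTaylor n N z := by
  have hR : 0 < R := Metric.pos_of_mem_ball hz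
  have hne : ∀ t ∈ Metric.sphere c R, t - z ≠ 0 := fun t ht => sub_ne_zero.mpr fun h => by
    have h1 := Metric.mem_ball.mp (h ▸ hz)
    rw [Metric.mem_sphere.mp ht] at h1
    exact lt_irrefl _ h1
  have hi : ∀ j : ℕ, CircleIntegrable
      (fun t => legendreTaylor n j z * (t - z) ^ ((j : ℤ) - N - 1)) c R := fun j =>
    (continuousOn_const.mul ((continuousOn_id.sub continuousOn_const).zpow₀ _
      fun t ht => Or.inl (hne t ht))).circleIntegrable hR.le
  rw [circleIntegral.integral_congr hR.le fun t ht => sq_sub_one_pow_mul_zpow n N (hne t ht),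
    circleIntegral.integral_fun_sum fun j _ => hi j]
  rw [Finset.sum_eq_single N]
  · rw [circleIntegral.integral_const_mul, sub_self, zero_sub]
    simp only [zpow_neg_one]
    rw [circleIntegral.integral_sub_inv_of_mem_ball hz]
    ring
  · intro j _ hj
    rw [circleIntegral.integral_const_mul, circleIntegral.integral_sub_zpow_of_ne (by omega),
      mul_zero]
  · intro h
    exact absurd (Finset.mem_range.mpr (by omega)) h

theorem circleIntegral_log_mul_sq_sub_one_pow {c z : ℂ} {R : ℝ} (hz : z ∈ Metric.ball c R)
    (h1 : 1 ∈ Metric.ball c R)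
    (hcut : ∀ t ∈ Metric.closedBall c R, t + 1 ∈ Complex.slitPlane)
    (n N : ℕ) (hN : N ≤ 2 * n) :
    circleIntegral (fun t => (Complex.log ((t - 1) / (t - z)) + Complex.log ((t + 1) / 2)) *
        ((t ^ 2 - 1) ^ n * (t - z) ^ (-(N : ℤ) - 1))) c R =
      2 * Real.pi * Complex.I * (legendreTaylor n N z * Complex.log ((z + 1) / 2) +
        legendrePhiLower n N z (z + 1) - legendrePhiUpper n N z (z - 1)) := by
  have hR : 0 < R := Metric.pos_of_mem_ball hz
  have hout : ∀ t ∈ Metric.sphere c R, t ∉ Metric.ball c R := fun t ht h =>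
    absurd (Metric.mem_ball.mp h) (by rw [Metric.mem_sphere.mp ht]; exact lt_irrefl R)
  have hne : ∀ t ∈ Metric.sphere c R, t - z ≠ 0 := fun t ht => sub_ne_zero.mpr fun h =>
    hout t ht (h ▸ hz)
  have hpow : ∀ j : ℕ, ContinuousOn (fun t : ℂ => (t - z) ^ ((j : ℤ) - N - 1))
      (Metric.sphere c R) := fun j =>
    (continuousOn_id.sub continuousOn_const).zpow₀ _ fun t ht => Or.inl (hne t ht)
  have hl1 : ContinuousOn (fun t => Complex.log ((t - 1) / (t - z))) (Metric.sphere c R) :=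
    fun t ht => (hasDerivAt_log_sub_div_sub h1 hz (hout t ht)).continuousAt.continuousWithinAt
  have hl2 : ContinuousOn (fun t : ℂ => Complex.log ((t + 1) / 2)) (Metric.sphere c R) := by
    refine ((continuousOn_id.add continuousOn_const).div_const 2).clog fun t ht => ?_
    have := hcut t (Metric.sphere_subset_closedBall ht)
    rw [Complex.mem_slitPlane_iff] at this ⊢
    simpa using this
  have i1 : ∀ j : ℕ, CircleIntegrable (fun t => Complex.log ((t - 1) / (t - z)) *
      (t - z) ^ ((j : ℤ) - N - 1)) c R := fun j => (hl1.mul (hpow j)).circleIntegrable hR.le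
  have i2 : ∀ j : ℕ, CircleIntegrable (fun t => Complex.log ((t + 1) / 2) *
      (t - z) ^ ((j : ℤ) - N - 1)) c R := fun j => (hl2.mul (hpow j)).circleIntegrable hR.le
  have i3 : ∀ j : ℕ, CircleIntegrable (fun t => legendreTaylor n j z *
      (Complex.log ((t - 1) / (t - z)) * (t - z) ^ ((j : ℤ) - N - 1) +
        Complex.log ((t + 1) / 2) * (t - z) ^ ((j : ℤ) - N - 1))) c R := fun j =>
    (continuousOn_const.mul ((hl1.mul (hpow j)).add (hl2.mul (hpow j)))).circleIntegrable hR.le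
  have e : circleIntegral (fun t => (Complex.log ((t - 1) / (t - z)) +
        Complex.log ((t + 1) / 2)) * ((t ^ 2 - 1) ^ n * (t - z) ^ (-(N : ℤ) - 1))) c R =
      circleIntegral (fun t => ∑ j ∈ Finset.range (2 * n + 1), legendreTaylor n j z *
        (Complex.log ((t - 1) / (t - z)) * (t - z) ^ ((j : ℤ) - N - 1) +
          Complex.log ((t + 1) / 2) * (t - z) ^ ((j : ℤ) - N - 1))) c R := by
    refine circleIntegral.integral_congr hR.le fun t ht => ?_
    rw [sq_sub_one_pow_mul_zpow n N (hne t ht), Finset.mul_sum]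
    exact Finset.sum_congr rfl fun j _ => by ring
  rw [e, circleIntegral.integral_fun_sum fun j _ => i3 j]
  have e2 : ∀ j ∈ Finset.range (2 * n + 1), circleIntegral (fun t => legendreTaylor n j z *
        (Complex.log ((t - 1) / (t - z)) * (t - z) ^ ((j : ℤ) - N - 1) +
          Complex.log ((t + 1) / 2) * (t - z) ^ ((j : ℤ) - N - 1))) c R =
      2 * Real.pi * Complex.I *
        ((if N = j then legendreTaylor n j z * Complex.log ((z + 1) / 2) else 0) +
        (if j < N then legendreTaylor n j z * (-(z + 1)) ^ ((j : ℤ) - N) / ((j : ℂ) - N) else 0) -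
        (if N < j then legendreTaylor n j z * (-(z - 1)) ^ (j - N) / ((j : ℂ) - N) else 0)) := by
    intro j _
    rw [circleIntegral.integral_const_mul, circleIntegral.integral_add (i1 j) (i2 j),
      circleIntegral_log_mul_zpow hz hcut, circleIntegral_log_sub_div_sub_mul_zpow hz h1]
    rcases lt_trichotomy j N with h | h | h
    · simp only [h, h.ne', h.not_gt, if_true, if_false]
      ring
    · simp only [h, lt_irrefl, if_true, if_false]
      ring
    · simp only [h, h.ne, h.ne', h.not_gt, if_true, if_false]
      ring
  rw [Finset.sum_congr rfl e2, ← Finset.mul_sum, Finset.sum_sub_distrib, Finset.sum_add_distrib,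
    Finset.sum_ite_eq, if_pos (Finset.mem_range.mpr (by omega))]
  rfl

/-- Value and degree derivative at `ν = n` of the contour integral in `legendreP`. -/
theorem exists_legendreP_eq_mul (n m : ℕ) (hmn : m ≤ n) (z : ℂ)
    (hz : z + 1 ∈ Complex.slitPlane) :
    ∃ J : ℂ → ℂ, (∀ ν, legendreP ν m z = (ascPochhammer ℂ m).eval (ν + 1) *
        ((z - 1) ^ ((m : ℂ) / 2) * (z + 1) ^ ((m : ℂ) / 2)) * J ν) ∧
      J n = (2 ^ n)⁻¹ * legendreTaylor n (n + m) z ∧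
      HasDerivAt J ((2 ^ n)⁻¹ * (legendreTaylor n (n + m) z * Complex.log ((z + 1) / 2) +
        legendrePhiLower n (n + m) z (z + 1) - legendrePhiUpper n (n + m) z (z - 1))) n := by
  obtain ⟨h1, hzb, hcut⟩ := (exists_schlafliCircle z hz).choose_spec
  set c := (exists_schlafliCircle z hz).choose.1 with hc
  set R := (exists_schlafliCircle z hz).choose.2 with hRdef
  have hR : 0 < R := Metric.pos_of_mem_ball h1
  have hout : ∀ t ∈ Metric.sphere c R, t ∉ Metric.ball c R := fun t ht h =>
    absurd (Metric.mem_ball.mp h) (by rw [Metric.mem_sphere.mp ht]; exact lt_irrefl R)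
  have hne : ∀ t ∈ Metric.sphere c R, t - z ≠ 0 := fun t ht => sub_ne_zero.mpr fun h =>
    hout t ht (h ▸ hzb)
  have hpi : (2 * (Real.pi : ℂ) * Complex.I) ≠ 0 := Complex.two_pi_I_ne_zero
  have hslit : ∀ t ∈ Metric.sphere c R, (t + 1) / 2 ∈ Complex.slitPlane := fun t ht => by
    have := hcut t (Metric.sphere_subset_closedBall ht)
    rw [Complex.mem_slitPlane_iff] at this ⊢
    simpa using this
  have hl1 : ContinuousOn (fun t => Complex.log ((t - 1) / (t - z))) (Metric.sphere c R) :=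
    fun t ht => (hasDerivAt_log_sub_div_sub h1 hzb (hout t ht)).continuousAt.continuousWithinAt
  have hl2 : ContinuousOn (fun t : ℂ => Complex.log ((t + 1) / 2)) (Metric.sphere c R) :=
    ((continuousOn_id.add continuousOn_const).div_const 2).clog hslit
  set g : ℂ → ℂ := fun t => Complex.log ((t - 1) / (t - z)) + Complex.log ((t + 1) / 2) with hg
  set h : ℂ → ℂ := fun t => ((t - z) ^ (m + 1))⁻¹ with hh
  have hgc : ContinuousOn g (Metric.sphere c R) := hl1.add hl2
  have hhc : ContinuousOn h (Metric.sphere c R) :=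
    ((continuousOn_id.sub continuousOn_const).pow _).inv₀ fun t ht => pow_ne_zero _ (hne t ht)
  -- Each principal power is expanded separately, so the two logarithms add in the exponent with no
  -- branch correction.
  have hint : ∀ ν : ℂ, ∀ t ∈ Metric.sphere c R,
      ((t - 1) / (t - z)) ^ ν * ((t + 1) / 2) ^ ν / (t - z) ^ (m + 1) =
        Complex.exp (ν * g t) * h t := by
    intro ν t ht
    rw [Complex.cpow_def_of_ne_zero
        (Complex.slitPlane_ne_zero (sub_div_sub_mem_slitPlane h1 hzb (hout t ht))),
      Complex.cpow_def_of_ne_zero (Complex.slitPlane_ne_zero (hslit t ht)), ← Complex.exp_add,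
      ← add_mul, mul_comm (_ + _) ν, div_eq_mul_inv]
  have hnat : ∀ t ∈ Metric.sphere c R, Complex.exp ((n : ℂ) * g t) * h t =
      (2 ^ n)⁻¹ * ((t ^ 2 - 1) ^ n * (t - z) ^ (-((n + m : ℕ) : ℤ) - 1)) := by
    intro t ht
    have htz := hne t ht
    rw [← hint n t ht, Complex.cpow_natCast, Complex.cpow_natCast,
      show (-((n + m : ℕ) : ℤ) - 1) = -((n + (m + 1) : ℕ) : ℤ) by push_cast; ring, zpow_neg,
      zpow_natCast, pow_add, ← mul_pow, show t ^ 2 - 1 = (t - 1) * (t + 1) by ring]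
    rw [div_mul_div_comm, div_pow, mul_pow (t - z)]
    field_simp
    ring
  refine ⟨fun ν => (2 * (Real.pi : ℂ) * Complex.I)⁻¹ *
    circleIntegral (fun t => Complex.exp (ν * g t) * h t) c R, fun ν => ?_, ?_, ?_⟩
  · rw [legendreP, dif_pos hz]
    congr 2
    exact circleIntegral.integral_congr hR.le fun t ht => hint ν t ht
  · simp only
    rw [circleIntegral.integral_congr hR.le fun t ht => hnat t ht,
      circleIntegral.integral_const_mul,
      circleIntegral_sq_sub_one_pow_mul_zpow hzb n (n + m) (by omega)]
    field_simp
  · refine ((hasDerivAt_circleIntegral_exp_mul hR.le hgc hhc n).const_mul _).congr_deriv ?_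
    have e : circleIntegral (fun t => g t * (Complex.exp ((n : ℂ) * g t) * h t)) c R =
        circleIntegral (fun t => (2 ^ n)⁻¹ *
          (g t * ((t ^ 2 - 1) ^ n * (t - z) ^ (-((n + m : ℕ) : ℤ) - 1)))) c R := by
      refine circleIntegral.integral_congr hR.le fun t ht => ?_
      rw [hnat t ht]
      ring
    rw [e, circleIntegral.integral_const_mul,
      circleIntegral_log_mul_sq_sub_one_pow hzb h1 hcut n (n + m) (by omega)]
    field_simp

/-! ### From z to -z, and the limit defining Q. -/

theorem legendrePhiLower_neg (n N : ℕ) (z a : ℂ) :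
    legendrePhiLower n N (-z) (-a) = (-1) ^ N * legendrePhiLower n N z a := by
  rw [legendrePhiLower, legendrePhiLower, Finset.mul_sum]
  refine Finset.sum_congr rfl fun j _ => ?_
  split_ifs with h
  · have h1 : (-(-a)) ^ ((j : ℤ) - N) = (-1) ^ ((j : ℤ) - N) * (-a) ^ ((j : ℤ) - N) := by
      rw [← mul_zpow]
      congr 1
      ring
    have h2 : (-1 : ℂ) ^ j * (-1) ^ ((j : ℤ) - N) = (-1) ^ N := by
      rw [← zpow_natCast, ← zpow_natCast, ← zpow_add₀ (by norm_num),
        show (j : ℤ) + (j - N) = N + 2 * (j - N) by ring, zpow_add₀ (by norm_num), zpow_mul]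
      norm_num
    rw [legendreTaylor_neg, h1, ← h2]
    ring
  · rw [mul_zero]

theorem legendrePhiUpper_neg (n N : ℕ) (z a : ℂ) :
    legendrePhiUpper n N (-z) (-a) = (-1) ^ N * legendrePhiUpper n N z a := by
  rw [legendrePhiUpper, legendrePhiUpper, Finset.mul_sum]
  refine Finset.sum_congr rfl fun j _ => ?_
  split_ifs with h
  · obtain ⟨d, rfl⟩ : ∃ d, j = N + d := ⟨j - N, by omega⟩
    have h2 : (-1 : ℂ) ^ d * (-1) ^ d = 1 := by rw [← mul_pow]; simp
    rw [legendreTaylor_neg, neg_pow (-a), Nat.add_sub_cancel_left, pow_add]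
    linear_combination ((-1) ^ N * legendreTaylor n (N + d) z * (-a) ^ d /
      (((N + d : ℕ) : ℂ) - N)) * h2
  · rw [mul_zero]

theorem exp_sign_mul_natCast {x : ℝ} (hx : x ≠ 0) (k : ℕ) :
    Complex.exp (-(Real.sign x : ℂ) * Complex.I * Real.pi * k) = (-1) ^ k := by
  rw [show -(Real.sign x : ℂ) * Complex.I * Real.pi * k =
    k * (-(Real.sign x : ℂ) * Complex.I * Real.pi) by ring, Complex.exp_nat_mul]
  congr 1
  rcases Real.sign_apply_eq_of_ne_zero x hx with h | h
  · rw [h, show -((-1 : ℝ) : ℂ) * Complex.I * Real.pi = Real.pi * Complex.I by push_cast; ring,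
      Complex.exp_pi_mul_I]
  · rw [h, show -((1 : ℝ) : ℂ) * Complex.I * Real.pi = -(Real.pi * Complex.I) by push_cast; ring,
      Complex.exp_neg, Complex.exp_pi_mul_I]
    norm_num

theorem log_neg_of_im_ne_zero {x : ℂ} (hx : x.im ≠ 0) :
    Complex.log (-x) = Complex.log x - Real.sign x.im * Complex.I * Real.pi := by
  rw [Complex.log, Complex.log, norm_neg]
  rcases lt_or_gt_of_ne hx with h | h
  · rw [Complex.arg_neg_eq_arg_add_pi_of_im_neg h, Real.sign_of_neg h]
    push_cast
    ring
  · rw [Complex.arg_neg_eq_arg_sub_pi_of_im_pos h, Real.sign_of_pos h]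
    push_cast
    ring

/-- Both logarithms shift by the same -σπi, where σ is the sign of Im z; the two half-powers
together give e^{-σπim} = (-1)^m. -/
theorem neg_sub_cpow_mul_neg_add_cpow {z : ℂ} (hz : z.im ≠ 0) (m : ℕ) :
    (-z - 1) ^ ((m : ℂ) / 2) * (-z + 1) ^ ((m : ℂ) / 2) =
      (-1) ^ m * ((z - 1) ^ ((m : ℂ) / 2) * (z + 1) ^ ((m : ℂ) / 2)) := by
  have h1 : (z + 1).im = z.im := by simp
  have h2 : (z - 1).im = z.im := by simp
  have n1 : z + 1 ≠ 0 := fun h => hz (by rw [← h1, h, Complex.zero_im])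
  have n2 : z - 1 ≠ 0 := fun h => hz (by rw [← h2, h, Complex.zero_im])
  rw [show -z - 1 = -(z + 1) by ring, show -z + 1 = -(z - 1) by ring,
    Complex.cpow_def_of_ne_zero (neg_ne_zero.mpr n1),
    Complex.cpow_def_of_ne_zero (neg_ne_zero.mpr n2), Complex.cpow_def_of_ne_zero n1,
    Complex.cpow_def_of_ne_zero n2, log_neg_of_im_ne_zero (by rwa [h1]),
    log_neg_of_im_ne_zero (by rwa [h2]), h1, h2, ← exp_sign_mul_natCast hz m, ← Complex.exp_add,
    ← Complex.exp_add, ← Complex.exp_add]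
  congr 1
  ring

/-- The closed form of the Legendre function of the second kind of integer degree. -/
noncomputable def legendreQClosed (n m : ℕ) (z : ℂ) : ℂ :=
  1 / 2 * ((ascPochhammer ℂ m).eval ((n : ℂ) + 1) *
    ((z - 1) ^ ((m : ℂ) / 2) * (z + 1) ^ ((m : ℂ) / 2)) * (2 ^ n)⁻¹) *
    (legendreTaylor n (n + m) z * (Complex.log ((z + 1) / 2) - Complex.log ((z - 1) / 2)) +
      (legendrePhi n (n + m) z (z + 1) - legendrePhi n (n + m) z (z - 1)))

/-- L'Hôpital's rule at ν = n, after the regular factor (ν+1)_m A has been split off numerator and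
sine quotient. -/
theorem tendsto_legendreQQuot (n m : ℕ) (hmn : m ≤ n) (z : ℂ) (hz : z.im ≠ 0) :
    Filter.Tendsto (fun ν : ℂ => legendreQQuot ν m z) (nhdsWithin (n : ℂ) {(n : ℂ)}ᶜ)
      (nhds (legendreQClosed n m z)) := by
  obtain ⟨J₁, hJ₁, hJ₁n, hJ₁d⟩ := exists_legendreP_eq_mul n m hmn z
    (Complex.mem_slitPlane_iff.mpr (Or.inr (by simpa using hz)))
  obtain ⟨J₂, hJ₂, hJ₂n, hJ₂d⟩ := exists_legendreP_eq_mul n m hmn (-z)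
    (Complex.mem_slitPlane_iff.mpr (Or.inr (by simpa using hz)))
  have hJ₁c : J₁ n = (2 ^ n)⁻¹ * legendreTaylor n (n + m) z := hJ₁n
  set σ : ℂ := (Real.sign z.im : ℂ) with hσ
  set A : ℂ := (z - 1) ^ ((m : ℂ) / 2) * (z + 1) ^ ((m : ℂ) / 2) with hA
  set B : ℂ → ℂ := fun ν => Complex.exp (-σ * Complex.I * Real.pi * ν) * J₁ ν - (-1) ^ m * J₂ ν
    with hB
  set B' : ℂ := (2 ^ n)⁻¹ * (-1) ^ n *
    (legendreTaylor n (n + m) z * (Complex.log ((z + 1) / 2) - Complex.log ((z - 1) / 2)) +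
      (legendrePhi n (n + m) z (z + 1) - legendrePhi n (n + m) z (z - 1))) with hB'
  have s1 : (-1 : ℂ) ^ n * (-1) ^ n = 1 := by rw [← mul_pow]; simp
  have s2 : (-1 : ℂ) ^ m * (-1) ^ m = 1 := by rw [← mul_pow]; simp
  have hBn : B n = 0 := by
    simp only [hB]
    rw [hσ, exp_sign_mul_natCast hz, hJ₁n, hJ₂n, legendreTaylor_neg, pow_add]
    linear_combination (-((-1) ^ n * (2 ^ n)⁻¹ * legendreTaylor n (n + m) z)) * s2
  have hBd : HasDerivAt B B' n := by
    have h1 : HasDerivAt (fun ν : ℂ => Complex.exp (-σ * Complex.I * Real.pi * ν))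
        (Complex.exp (-σ * Complex.I * Real.pi * n) * (-σ * Complex.I * Real.pi * 1)) n :=
      ((hasDerivAt_id (n : ℂ)).const_mul _).cexp
    refine ((h1.mul hJ₁d).sub (hJ₂d.const_mul ((-1) ^ m))).congr_deriv ?_
    -- The shift -σπi in this logarithm cancels the one from differentiating e^{-σπiν}, so the limit
    -- does not depend on the half-plane.
    have h2 : Complex.log ((-z + 1) / 2) =
        Complex.log ((z - 1) / 2) - σ * Complex.I * Real.pi := by
      have h3 : ((z - 1) / 2).im = z.im / 2 := by simp
      have h4 : Real.sign (z.im / 2) = Real.sign z.im := by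
        rcases lt_or_gt_of_ne hz with h | h
        · rw [Real.sign_of_neg h, Real.sign_of_neg (by linarith)]
        · rw [Real.sign_of_pos h, Real.sign_of_pos (by linarith)]
      rw [show (-z + 1) / 2 = -((z - 1) / 2) by ring, log_neg_of_im_ne_zero (by rw [h3]; simpa),
        h3, h4]
    have h5 := legendrePhiLower_neg n (n + m) z (z - 1)
    have h6 := legendrePhiUpper_neg n (n + m) z (z + 1)
    rw [show -(z - 1) = -z + 1 by ring] at h5
    rw [show -(z + 1) = -z - 1 by ring] at h6
    rw [h2, h5, h6, hJ₁n, legendreTaylor_neg, hσ, exp_sign_mul_natCast hz, hB',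
      legendrePhi_eq_add, legendrePhi_eq_add, ← hσ, pow_add]
    linear_combination (-((2 ^ n)⁻¹ * (-1) ^ n * (legendreTaylor n (n + m) z *
      (Complex.log ((z - 1) / 2) - σ * Complex.I * Real.pi) + legendrePhiLower n (n + m) z (z - 1)
        - legendrePhiUpper n (n + m) z (z + 1)))) * s2
  have hsin : HasDerivAt (fun ν : ℂ => Complex.sin (Real.pi * (ν + m)))
      (Real.pi * ((-1) ^ n * (-1) ^ m)) n := by
    have h1 := (((hasDerivAt_id (n : ℂ)).add_const (m : ℂ)).const_mul (Real.pi : ℂ)).csin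
    refine h1.congr_deriv ?_
    have h2 : Complex.cos (Real.pi * ((n : ℂ) + m)) = (-1) ^ n * (-1) ^ m := by
      rw [← pow_add, show (Real.pi : ℂ) * ((n : ℂ) + m) = ((((n + m : ℕ) : ℝ) * Real.pi : ℝ) : ℂ) by
        push_cast; ring, ← Complex.ofReal_cos, Real.cos_nat_mul_pi]
      push_cast
      rfl
    simp only [id_eq]
    rw [h2]
    ring
  have hsin0 : Complex.sin (Real.pi * ((n : ℂ) + m)) = 0 := by
    rw [mul_comm]
    exact_mod_cast Complex.sin_nat_mul_pi (n + m)
  have hpi : (Real.pi : ℂ) ≠ 0 := Complex.ofReal_ne_zero.mpr Real.pi_ne_zero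
  have hd0 : (Real.pi : ℂ) * ((-1) ^ n * (-1) ^ m) ≠ 0 :=
    mul_ne_zero hpi (mul_ne_zero (pow_ne_zero _ (by norm_num)) (pow_ne_zero _ (by norm_num)))
  -- Both functions vanish at n, so their quotient is the quotient of their slopes.
  have hq := (hasDerivAt_iff_tendsto_slope.mp hBd).div (hasDerivAt_iff_tendsto_slope.mp hsin) hd0
  have hp : Filter.Tendsto (fun ν : ℂ => (Real.pi : ℂ) / 2 * Complex.exp (Complex.I * Real.pi * m) *
      ((ascPochhammer ℂ m).eval (ν + 1) * A)) (nhdsWithin (n : ℂ) {(n : ℂ)}ᶜ)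
      (nhds ((Real.pi : ℂ) / 2 * Complex.exp (Complex.I * Real.pi * m) *
        ((ascPochhammer ℂ m).eval ((n : ℂ) + 1) * A))) := by
    have : Continuous fun ν : ℂ => (Real.pi : ℂ) / 2 * Complex.exp (Complex.I * Real.pi * m) *
        ((ascPochhammer ℂ m).eval (ν + 1) * A) := by fun_prop
    exact this.continuousAt.continuousWithinAt
  have hfin := hp.mul hq
  have hexp : Complex.exp (Complex.I * Real.pi * m) = (-1) ^ m := by
    rw [show Complex.I * Real.pi * m = m * (Real.pi * Complex.I) by ring, Complex.exp_nat_mul,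
      Complex.exp_pi_mul_I]
  have hval : (Real.pi : ℂ) / 2 * Complex.exp (Complex.I * Real.pi * m) *
      ((ascPochhammer ℂ m).eval ((n : ℂ) + 1) * A) * (B' / (Real.pi * ((-1) ^ n * (-1) ^ m))) =
      legendreQClosed n m z := by
    have e1 : (-1 : ℂ) ^ n ≠ 0 := pow_ne_zero _ (by norm_num)
    have e2 : (-1 : ℂ) ^ m ≠ 0 := pow_ne_zero _ (by norm_num)
    rw [hexp, legendreQClosed, ← hA, hB']
    field_simp
  rw [hval] at hfin
  refine hfin.congr' ?_
  filter_upwards [self_mem_nhdsWithin] with ν hν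
  have hν' : ν - n ≠ 0 := sub_ne_zero.mpr hν
  simp only [slope_def_field, hBn, hsin0, sub_zero, Pi.div_apply]
  rw [div_div_div_cancel_right₀ hν', legendreQQuot, hJ₁, hJ₂, neg_sub_cpow_mul_neg_add_cpow hz,
    ← hA, ← hσ, hB]
  ring

theorem continuousAt_legendreQClosed (n m : ℕ) {z : ℂ} (hz : z - 1 ∈ Complex.slitPlane) :
    ContinuousAt (legendreQClosed n m) z := by
  have hz' : z + 1 ∈ Complex.slitPlane := by
    rw [Complex.mem_slitPlane_iff] at hz ⊢
    simp only [Complex.sub_re, Complex.sub_im, Complex.add_re, Complex.add_im, Complex.one_re,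
      Complex.one_im, sub_zero, add_zero] at hz ⊢
    rcases hz with h | h
    · left; linarith
    · right; exact h
  have hhalf : ∀ {x : ℂ}, x ∈ Complex.slitPlane → x / 2 ∈ Complex.slitPlane := fun {x} hx => by
    rw [Complex.mem_slitPlane_iff] at hx ⊢
    simpa using hx
  have c1 : ContinuousAt (fun z : ℂ => z - 1) z := by fun_prop
  have c2 : ContinuousAt (fun z : ℂ => z + 1) z := by fun_prop
  have hΦ : ∀ {a : ℂ → ℂ}, ContinuousAt a z → a z ≠ 0 →
      ContinuousAt (fun z => legendrePhi n (n + m) z (a z)) z := fun {a} ha ha0 => by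
    unfold legendrePhi
    refine tendsto_finsetSum _ fun j _ => ?_
    exact ((continuous_legendreTaylor n j).continuousAt.mul
      (ha.neg.zpow₀ _ (Or.inl (neg_ne_zero.mpr ha0)))).div_const _
  unfold legendreQClosed
  exact (continuousAt_const.mul ((continuousAt_const.mul
    ((c1.cpow continuousAt_const hz).mul (c2.cpow continuousAt_const hz'))).mul
      continuousAt_const)).mul
    (((continuous_legendreTaylor n _).continuousAt.mul
      (((c2.div_const 2).clog (hhalf hz')).sub ((c1.div_const 2).clog (hhalf hz)))).add
      ((hΦ c2 (Complex.slitPlane_ne_zero hz')).sub (hΦ c1 (Complex.slitPlane_ne_zero hz))))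

theorem legendreQ_eq_of_im_ne_zero (n m : ℕ) (hmn : m ≤ n) {z : ℂ} (hz : z.im ≠ 0) :
    legendreQ n m z = legendreQClosed n m z := by
  rw [legendreQ, if_pos hz]
  exact (tendsto_legendreQQuot n m hmn z hz).limUnder_eq

/-- Nontriviality of the filter makes the limit through non-real points unique, as `limUnder`
requires. -/
theorem nhdsWithin_im_ne_zero_neBot (z : ℂ) : (nhdsWithin z {w : ℂ | w.im ≠ 0}).NeBot := by
  rw [← mem_closure_iff_nhdsWithin_neBot, Metric.mem_closure_iff]
  intro e he
  by_cases hz : z.im = 0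
  · refine ⟨z + (e / 2 : ℝ) * Complex.I, ?_, ?_⟩
    · simp [hz, he.ne']
    · rw [dist_eq_norm]
      simp [abs_of_pos he]
      exact he
  · exact ⟨z, hz, by simpa using he⟩

theorem tendsto_legendreQ_closed (n m : ℕ) (hmn : m ≤ n) {z : ℂ}
    (hz : z - 1 ∈ Complex.slitPlane) :
    Filter.Tendsto (fun w : ℂ => legendreQ n m w) (nhdsWithin z {w : ℂ | w.im ≠ 0})
      (nhds (legendreQClosed n m z)) := by
  refine ((continuousAt_legendreQClosed n m hz).continuousWithinAt
    (s := {w : ℂ | w.im ≠ 0})).tendsto.congr' ?_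
  filter_upwards [self_mem_nhdsWithin] with w hw
  exact (legendreQ_eq_of_im_ne_zero n m hmn hw).symm

theorem legendreQ_eq (n m : ℕ) (hmn : m ≤ n) {z : ℂ} (hz : z - 1 ∈ Complex.slitPlane) :
    legendreQ n m z = legendreQClosed n m z := by
  by_cases him : z.im = 0
  · have := nhdsWithin_im_ne_zero_neBot z
    have h := (tendsto_legendreQ_closed n m hmn hz).limUnder_eq
    rw [← h, legendreQ, if_neg (not_not.mpr him)]
    refine Filter.Tendsto.limUnder_eq ?_
    rw [h]
    refine (tendsto_legendreQ_closed n m hmn hz).congr' ?_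
    filter_upwards [self_mem_nhdsWithin] with w hw
    rw [legendreQ, if_pos hw]
  · exact legendreQ_eq_of_im_ne_zero n m hmn him

/-! ### Digamma values and half-integer powers. -/

theorem digamma_natCast_add_one (k : ℕ) :
    Complex.digamma ((k : ℂ) + 1) = harmonic k - Real.eulerMascheroniConstant := by
  induction k with
  | zero => simp [Complex.digamma_one]
  | succ k ih =>
    rw [Complex.digamma_apply_add_one, Nat.cast_succ, ih, harmonic_succ]
    · push_cast
      ring
    · intro j h
      have : ((k + 1 + j : ℕ) : ℂ) = 0 := by
        push_cast at h ⊢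
        rw [h]
        ring
      exact absurd (Nat.cast_eq_zero.mp this) (by omega)

theorem ascPochhammer_eval_natCast_add_one (n m : ℕ) :
    (ascPochhammer ℂ m).eval ((n : ℂ) + 1) = ((n + m).factorial : ℂ) / n.factorial := by
  have h : (ascPochhammer ℂ m).eval ((n : ℂ) + 1) = (((n + 1).ascFactorial m : ℕ) : ℂ) := by
    rw [← ascPochhammer_nat_eq_ascFactorial, ascPochhammer_eval_cast]
    push_cast
    rfl
  rw [h, eq_div_iff (Nat.cast_ne_zero.mpr n.factorial_ne_zero), mul_comm]
  exact_mod_cast Nat.factorial_mul_ascFactorial n m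

/-- z - 1 and z + 1 have the same imaginary part, so both arguments lie in [0, π) or both in (-π,
0). -/
theorem arg_sub_sub_arg_add_mem_Ioo {z : ℂ} (hz : z - 1 ∈ Complex.slitPlane) (ε : ℂ)
    (hε : ε = 1 ∨ ε = -1) :
    (z - ε).arg - (z + ε).arg ∈ Set.Ioo (-Real.pi) Real.pi := by
  have hz' : z + 1 ∈ Complex.slitPlane := by
    rw [Complex.mem_slitPlane_iff] at hz ⊢
    simp only [Complex.sub_re, Complex.sub_im, Complex.add_re, Complex.add_im, Complex.one_re,
      Complex.one_im, sub_zero, add_zero] at hz ⊢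
    rcases hz with h | h
    · left; linarith
    · right; exact h
  have key : |(z - 1).arg - (z + 1).arg| < Real.pi := by
    have i1 : (z - 1).im = z.im := by simp
    have i2 : (z + 1).im = z.im := by simp
    have a1 := Complex.arg_le_pi (z - 1)
    have a2 := Complex.arg_le_pi (z + 1)
    have a3 := Complex.neg_pi_lt_arg (z - 1)
    have a4 := Complex.neg_pi_lt_arg (z + 1)
    have p1 := lt_of_le_of_ne a1 (Complex.mem_slitPlane_iff_arg.mp hz).1
    have p2 := lt_of_le_of_ne a2 (Complex.mem_slitPlane_iff_arg.mp hz').1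
    rw [abs_lt]
    rcases lt_or_ge z.im 0 with h | h
    · have b1 := Complex.arg_neg_iff.mpr (i1 ▸ h)
      have b2 := Complex.arg_neg_iff.mpr (i2 ▸ h)
      constructor <;> linarith
    · have b1 := Complex.arg_nonneg_iff.mpr (i1 ▸ h)
      have b2 := Complex.arg_nonneg_iff.mpr (i2 ▸ h)
      constructor <;> linarith
  rw [abs_lt] at key
  rcases hε with rfl | rfl
  · exact key
  · rw [sub_neg_eq_add, ← sub_eq_add_neg]
    constructor <;> linarith [key.1, key.2]

theorem log_div_of_arg_sub_mem {a b : ℂ} (ha : a ≠ 0) (hb : b ≠ 0)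
    (h : a.arg - b.arg ∈ Set.Ioo (-Real.pi) Real.pi) :
    Complex.log (a / b) = Complex.log a - Complex.log b := by
  have h1 : (Complex.log a - Complex.log b).im = a.arg - b.arg := by simp [Complex.log_im]
  rw [← Complex.log_exp (x := Complex.log a - Complex.log b) (by rw [h1]; exact h.1)
    (by rw [h1]; exact h.2.le), Complex.exp_sub, Complex.exp_log ha, Complex.exp_log hb]

/-- b^{-m/2} = b^{m/2}/b^m. This and the `quarterPow` lemmas express all prefactors through the
single product A. -/
theorem div_cpow_natCast_div_two {a b : ℂ} (ha : a ≠ 0) (hb : b ≠ 0)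
    (h : a.arg - b.arg ∈ Set.Ioo (-Real.pi) Real.pi) (m : ℕ) :
    (a / b) ^ ((m : ℂ) / 2) = a ^ ((m : ℂ) / 2) * b ^ ((m : ℂ) / 2) / b ^ m := by
  rw [Complex.cpow_def_of_ne_zero (div_ne_zero ha hb), Complex.cpow_def_of_ne_zero ha,
    Complex.cpow_def_of_ne_zero hb, log_div_of_arg_sub_mem ha hb h, ← Complex.cpow_natCast b m,
    Complex.cpow_def_of_ne_zero hb, ← Complex.exp_add, ← Complex.exp_sub]
  congr 1
  ring

theorem div_two_cpow (a s : ℂ) (ha : a ≠ 0) : (a / 2) ^ s = a ^ s / 2 ^ s := by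
  have h2 : (a / 2) = ((1 / 2 : ℝ) : ℂ) * a := by push_cast; ring
  rw [Complex.cpow_def_of_ne_zero (div_ne_zero ha two_ne_zero), Complex.cpow_def_of_ne_zero ha,
    Complex.cpow_def_of_ne_zero two_ne_zero, h2, Complex.log_ofReal_mul (by norm_num) ha,
    ← Complex.exp_sub]
  have h3 : Complex.log 2 = (Real.log 2 : ℝ) := by
    rw [Complex.ofReal_log (by norm_num), Complex.ofReal_ofNat]
  congr 1
  rw [one_div, Real.log_inv, h3]
  push_cast
  ring

theorem quarterPow_div_two (z : ℂ) (h1 : z - 1 ≠ 0) (h2 : z + 1 ≠ 0) (m : ℕ) :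
    quarterPow z ((m : ℂ) / 2) =
      (z - 1) ^ ((m : ℂ) / 2) * (z + 1) ^ ((m : ℂ) / 2) / 2 ^ m := by
  have h : (2 : ℂ) ^ ((m : ℂ) / 2) * 2 ^ ((m : ℂ) / 2) = 2 ^ m := by
    rw [← Complex.cpow_add _ _ two_ne_zero, add_halves, Complex.cpow_natCast]
  rw [quarterPow, div_two_cpow _ _ h1, div_two_cpow _ _ h2, div_mul_div_comm, h]

theorem quarterPow_neg_div_two (z : ℂ) (h1 : z - 1 ≠ 0) (h2 : z + 1 ≠ 0) (m : ℕ) :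
    quarterPow z (-(m : ℂ) / 2) =
      (z - 1) ^ ((m : ℂ) / 2) * (z + 1) ^ ((m : ℂ) / 2) * 2 ^ m / (z ^ 2 - 1) ^ m := by
  have h : ∀ a : ℂ, a ≠ 0 → (a / 2) ^ (-(m : ℂ) / 2) = (a / 2) ^ ((m : ℂ) / 2) * 2 ^ m / a ^ m := by
    intro a ha
    rw [show -(m : ℂ) / 2 = m / 2 - m by ring,
      Complex.cpow_sub _ _ (div_ne_zero ha two_ne_zero), Complex.cpow_natCast, div_pow, div_div_eq_mul_div]
  have hq := quarterPow_div_two z h1 h2 m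
  rw [quarterPow] at hq ⊢
  rw [h _ h1, h _ h2, show z ^ 2 - 1 = (z - 1) * (z + 1) by ring, mul_pow]
  have p1 := pow_ne_zero m h1
  have p2 := pow_ne_zero m h2
  have p3 : (2 : ℂ) ^ m ≠ 0 := pow_ne_zero _ two_ne_zero
  rw [eq_div_iff p3] at hq
  field_simp
  linear_combination hq

/-! ### Matching the sums of the formula, and the theorem. -/

/-- The expansion of `f_{n+m}` at `ε`, with arbitrary weights `X`. -/
theorem sum_weighted_upper (n m : ℕ) (hmn : m ≤ n) (y ε : ℂ) (hε : ε ^ 2 = 1) (X : ℕ → ℂ) :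
    ((n + m).factorial : ℂ) / n.factorial * (2 ^ n)⁻¹ *
      ∑ k ∈ Finset.range (n + 1), (n.choose k * (2 * ε) ^ (n - k)) *
        ((n + k).choose (n + m) * X (n + k) * y ^ (n + k - (n + m))) =
      ε ^ (n + m) / 2 ^ m * ∑ k ∈ Finset.range (n - m + 1), ε ^ k *
        (((k + n + m).factorial : ℂ) * X (k + n + m) /
          (k.factorial * (k + m).factorial * (n - m - k).factorial)) * (y / 2) ^ k := by
  -- The terms k < m vanish because C(n+k, n+m) = 0; the rest is shifted by m.
  rw [show n + 1 = m + (n - m + 1) by omega, Finset.sum_range_add, Finset.sum_eq_zero, zero_add,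
    Finset.mul_sum, Finset.mul_sum]
  · refine Finset.sum_congr rfl fun k hk => ?_
    have hk' : k ≤ n - m := by have := Finset.mem_range.mp hk; omega
    obtain ⟨d, hd⟩ : ∃ d, n = m + k + d := ⟨n - m - k, by omega⟩
    have f1 : (n.choose (m + k) : ℂ) =
        n.factorial / ((m + k).factorial * (n - (m + k)).factorial) :=
      Nat.cast_choose ℂ (by omega)
    have f2 : ((n + (m + k)).choose (n + m) : ℂ) =
        (n + (m + k)).factorial / ((n + m).factorial * (n + (m + k) - (n + m)).factorial) :=
      Nat.cast_choose ℂ (by omega)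
    have g : ∀ j : ℕ, (j.factorial : ℂ) ≠ 0 := fun j => Nat.cast_ne_zero.mpr j.factorial_ne_zero
    -- The exponents differ by the even number 2(m + k), and ε² = 1.
    have e1 : ε ^ (n + m) * ε ^ k = ε ^ d := by
      rw [← pow_add, show n + m + k = d + 2 * (m + k) by omega, pow_add, pow_mul, hε, one_pow,
        mul_one]
    rw [f1, f2, show n + (m + k) - (n + m) = k by omega, show n - (m + k) = d by omega,
      show n - m - k = d by omega, show k + n + m = n + (m + k) by ring, show k + m = m + k by ring,
      mul_pow, ← e1, div_pow]
    have g1 := g n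
    have g2 := g (n + m)
    have e2 : (2 : ℂ) ^ n = 2 ^ m * 2 ^ k * 2 ^ d := by rw [← pow_add, ← pow_add, ← hd]
    rw [e2]
    field_simp
  · intro k hk
    have := Finset.mem_range.mp hk
    rw [Nat.choose_eq_zero_of_lt (show n + k < n + m by omega)]
    simp

/-- The expansion of `f_{n-m}` at `ε`, with arbitrary weights `X`. -/
theorem sum_weighted_lower (n m : ℕ) (hmn : m ≤ n) (y w ε : ℂ) (hε : ε ^ 2 = 1) (hy : y ≠ 0)
    (hw : w ≠ 0) (X : ℕ → ℂ) :
    ((n + m).factorial : ℂ) / n.factorial * (2 ^ n)⁻¹ * (((w * y) ^ m)⁻¹ *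
      ∑ k ∈ Finset.range (n + 1), (n.choose k * (2 * ε) ^ (n - k)) *
        ((n + k).choose (n - m) * y ^ (n + k - (n - m)) * X k)) =
      ε ^ n * (((n + m).factorial : ℂ) / (n - m).factorial) / w ^ m *
      ∑ k ∈ Finset.range (n + 1), ε ^ k *
        (((k + n).factorial : ℂ) / (k.factorial * (k + m).factorial * (n - k).factorial)) *
          X k * (y / 2) ^ k := by
  simp only [Finset.mul_sum]
  refine Finset.sum_congr rfl fun k hk => ?_
  have hk' : k ≤ n := by have := Finset.mem_range.mp hk; omega
  obtain ⟨d, hd⟩ : ∃ d, n = k + d := ⟨n - k, by omega⟩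
  have f1 : (n.choose k : ℂ) = n.factorial / (k.factorial * (n - k).factorial) :=
    Nat.cast_choose ℂ hk'
  have f2 : ((n + k).choose (n - m) : ℂ) =
      (n + k).factorial / ((n - m).factorial * (n + k - (n - m)).factorial) :=
    Nat.cast_choose ℂ (by omega)
  have g : ∀ j : ℕ, (j.factorial : ℂ) ≠ 0 := fun j => Nat.cast_ne_zero.mpr j.factorial_ne_zero
  have e1 : ε ^ n * ε ^ k = ε ^ d := by
    rw [← pow_add, show n + k = d + 2 * k by omega, pow_add, pow_mul, hε, one_pow, mul_one]
  have g1 := g n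
  have e2 : (2 : ℂ) ^ n = 2 ^ k * 2 ^ d := by rw [← pow_add, ← hd]
  rw [f1, f2, show n + k - (n - m) = k + m by omega, show n - k = d by omega,
    show k + n = n + k by ring, mul_pow 2 ε, ← e1, div_pow, e2, mul_pow w, pow_add y]
  field_simp

/-- The coefficient C(Q, n-m) leaves only Q = n - m + k with 0 ≤ k < m. -/
theorem sum_finite_part (n m : ℕ) (hmn : m ≤ n) (y c ε : ℂ) (hε : ε ^ 2 = 1) :
    ((n + m).factorial : ℂ) / n.factorial * (2 ^ n)⁻¹ * ((c ^ m)⁻¹ * ∑ Q ∈ Finset.range n,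
        (Q.choose (n - m) : ℂ) * (2 * ε) ^ (2 * n - Q) * y ^ (Q - (n - m)) *
        ((-1) ^ (n - Q) * (((n - Q - 1).factorial * n.factorial : ℂ) /
          (2 * n - Q).factorial))) =
      ε ^ n * (-ε) ^ m * (((n + m).factorial : ℂ) / (n - m).factorial) * (2 ^ m / c ^ m) *
        ∑ k ∈ Finset.range m, (-ε) ^ k *
          (((k + n - m).factorial * (m - k - 1).factorial : ℂ) /
            (k.factorial * (n + m - k).factorial)) * (y / 2) ^ k := by
  have hr : Finset.range n = Finset.range (n - m + m) := by rw [Nat.sub_add_cancel hmn]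
  rw [hr, Finset.sum_range_add, Finset.sum_eq_zero (s := Finset.range (n - m)), zero_add]
  · simp only [Finset.mul_sum]
    refine Finset.sum_congr rfl fun k hk => ?_
    have hk' : k < m := Finset.mem_range.mp hk
    obtain ⟨d, hd⟩ : ∃ d, m = k + d := ⟨m - k, by omega⟩
    have f2 : ((n - m + k).choose (n - m) : ℂ) =
        (n - m + k).factorial / ((n - m).factorial * (n - m + k - (n - m)).factorial) :=
      Nat.cast_choose ℂ (by omega)
    have g : ∀ j : ℕ, (j.factorial : ℂ) ≠ 0 := fun j => Nat.cast_ne_zero.mpr j.factorial_ne_zero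
    have e1 : ε ^ n * (-ε) ^ m * (-ε) ^ k = ε ^ (n + d) * (-1) ^ d := by
      rw [neg_pow ε m, neg_pow ε k]
      have h1 : ε ^ n * ε ^ m * ε ^ k = ε ^ (n + d) := by
        rw [← pow_add, ← pow_add, show n + m + k = (n + d) + 2 * k by omega, pow_add, pow_mul, hε,
          one_pow, mul_one]
      have h2 : (-1 : ℂ) ^ m * (-1) ^ k = (-1) ^ d := by
        rw [← pow_add, show m + k = d + 2 * k by omega, pow_add, pow_mul]
        norm_num
      rw [← h1, ← h2]
      ring
    rw [f2, show n - m + k - (n - m) = k by omega, show 2 * n - (n - m + k) = n + d by omega,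
      show n - (n - m + k) = d by omega, show k + n - m = n - m + k by omega,
      show m - k - 1 = d - 1 by omega, show n + m - k = n + d by omega, mul_pow, div_pow]
    have g1 := g n
    have e2 : (2 : ℂ) ^ m = 2 ^ k * 2 ^ d := by rw [← pow_add, ← hd]
    have e3 : (2 : ℂ) ^ (n + d) = 2 ^ n * 2 ^ d := pow_add _ _ _
    calc _ = ε ^ (n + d) * (-1) ^ d * (((n + m).factorial : ℂ) / (n - m).factorial) *
          (2 ^ m / c ^ m) * (((n - m + k).factorial * (d - 1).factorial : ℂ) /
            (k.factorial * (n + d).factorial)) * (y ^ k / 2 ^ k) := by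
          rw [e2, e3]
          have g2 := g (n - m)
          field_simp
      _ = _ := by
          rw [← e1]
          ring
  · intro Q hQ
    have := Finset.mem_range.mp hQ
    rw [Nat.choose_eq_zero_of_lt this]
    simp

theorem mainTheorem7 (n m : ℕ) (hmn : m ≤ n) (z : ℂ) (hz : z - 1 ∈ Complex.slitPlane) :
    (z.im ≠ 0 →
      Filter.Tendsto (fun ν : ℂ => legendreQQuot ν m z) (nhdsWithin (n : ℂ) {(n : ℂ)}ᶜ)
        (nhds (legendreQ n m z))) ∧
    (z.im = 0 →
      Filter.Tendsto (fun w : ℂ => legendreQ n m w) (nhdsWithin z {w : ℂ | w.im ≠ 0})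
        (nhds (legendreQ n m z))) ∧
    ∀ ε : ℂ, ε = 1 ∨ ε = -1 →
      legendreQ n m z =
        1 / 2 * legendreP n m z * Complex.log ((z + 1) / (z - 1))
        - ε * (1 / 2) * (Complex.digamma (n + m + 1) + Complex.digamma (n + 1)) *
            legendreP n m z
        + ε * (ε ^ n * (-ε) ^ m / 2) * ((n + m).factorial / (n - m).factorial : ℂ) *
            quarterPow z (-(m : ℂ) / 2) *
            ∑ k ∈ Finset.range m, (-ε) ^ k *
              (((k + n - m).factorial * (m - k - 1).factorial : ℂ) /
                (k.factorial * (n + m - k).factorial)) * ((z - ε) / 2) ^ k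
        + ε * (ε ^ (n + m) / 2) * quarterPow z ((m : ℂ) / 2) *
            ∑ k ∈ Finset.range (n - m + 1), ε ^ k *
              (((k + n + m).factorial * Complex.digamma (k + n + m + 1) : ℂ) /
                (k.factorial * (k + m).factorial * (n - m - k).factorial)) * ((z - ε) / 2) ^ k
        - ε * (ε ^ n / 2) * ((n + m).factorial / (n - m).factorial : ℂ) *
            ((z - ε) / (z + ε)) ^ ((m : ℂ) / 2) *
            ∑ k ∈ Finset.range (n + 1), ε ^ k *
              ((k + n).factorial / (k.factorial * (k + m).factorial * (n - k).factorial) : ℂ) *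
              (Complex.digamma (k + n + 1) - Complex.digamma (k + m + 1)
                - Complex.digamma (k + 1)) * ((z - ε) / 2) ^ k := by
  have hQ := legendreQ_eq n m hmn hz
  refine ⟨fun him => ?_, fun _ => ?_, fun ε hε => ?_⟩
  · rw [hQ]
    exact tendsto_legendreQQuot n m hmn z him
  · rw [hQ]
    exact tendsto_legendreQ_closed n m hmn hz
  have hz' : z + 1 ∈ Complex.slitPlane := by
    rw [Complex.mem_slitPlane_iff] at hz ⊢
    simp only [Complex.sub_re, Complex.sub_im, Complex.add_re, Complex.add_im, Complex.one_re,
      Complex.one_im, sub_zero, add_zero] at hz ⊢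
    rcases hz with h | h
    · left; linarith
    · right; exact h
  have h1 := Complex.slitPlane_ne_zero hz
  have h2 := Complex.slitPlane_ne_zero hz'
  have hε2 : ε ^ 2 = 1 := by rcases hε with rfl | rfl <;> norm_num
  have hy : z - ε ≠ 0 := by
    rcases hε with rfl | rfl
    · exact h1
    · rwa [sub_neg_eq_add]
  have hw : z + ε ≠ 0 := by
    rcases hε with rfl | rfl
    · exact h2
    · rwa [← sub_eq_add_neg]
  have hc : (z + ε) * (z - ε) = z ^ 2 - 1 := by linear_combination -hε2
  have hc0 : z ^ 2 - 1 ≠ 0 := hc ▸ mul_ne_zero hw hy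
  obtain ⟨J, hJ, hJn, -⟩ := exists_legendreP_eq_mul n m hmn z hz'
  set A : ℂ := (z - 1) ^ ((m : ℂ) / 2) * (z + 1) ^ ((m : ℂ) / 2) with hA
  set K : ℂ := ((n + m).factorial : ℂ) / n.factorial with hK
  have hP : legendreP n m z = K * A * ((2 ^ n)⁻¹ * legendreTaylor n (n + m) z) := by
    rw [hJ, hJn, ascPochhammer_eval_natCast_add_one]
  -- Source of the overall sign ± in front of the rational terms: ε = -1 exchanges the two Φ's.
  have hΦ : legendrePhi n (n + m) z (z + 1) - legendrePhi n (n + m) z (z - 1) =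
      ε * (legendrePhi n (n + m) z (z + ε) - legendrePhi n (n + m) z (z - ε)) := by
    rcases hε with rfl | rfl
    · rw [one_mul]
    · rw [sub_neg_eq_add, ← sub_eq_add_neg]
      ring
  have hlog : Complex.log ((z + 1) / (z - 1)) =
      Complex.log ((z + 1) / 2) - Complex.log ((z - 1) / 2) := by
    have h := arg_sub_sub_arg_add_mem_Ioo hz (-1) (Or.inr rfl)
    rw [sub_neg_eq_add, ← sub_eq_add_neg] at h
    have hhalf : ∀ a : ℂ, a ≠ 0 → Complex.log (a / 2) = Complex.log a + Real.log (1 / 2) := by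
      intro a ha
      rw [show a / 2 = ((1 / 2 : ℝ) : ℂ) * a by push_cast; ring,
        Complex.log_ofReal_mul (by norm_num) ha, add_comm]
    rw [log_div_of_arg_sub_mem h2 h1 h, hhalf _ h2, hhalf _ h1]
    ring
  have hpow : ((z - ε) / (z + ε)) ^ ((m : ℂ) / 2) = A / (z + ε) ^ m := by
    rw [div_cpow_natCast_div_two hy hw (arg_sub_sub_arg_add_mem_Ioo hz ε hε)]
    congr 1
    rcases hε with rfl | rfl
    · rfl
    · rw [sub_neg_eq_add, ← sub_eq_add_neg, mul_comm]
  have d1 : Complex.digamma ((n : ℂ) + m + 1) =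
      harmonic (n + m) - Real.eulerMascheroniConstant := by
    rw [← digamma_natCast_add_one]; push_cast; rfl
  have d2 : ∀ k : ℕ, Complex.digamma ((k : ℂ) + n + m + 1) =
      harmonic (k + n + m) - Real.eulerMascheroniConstant := fun k => by
    rw [← digamma_natCast_add_one]; push_cast; rfl
  have d3 : ∀ k j : ℕ, Complex.digamma ((k : ℂ) + j + 1) =
      harmonic (k + j) - Real.eulerMascheroniConstant := fun k j => by
    rw [← digamma_natCast_add_one]; push_cast; rfl
  set γ : ℂ := (Real.eulerMascheroniConstant : ℂ) with hγ
  set T : ℂ := legendreTaylor n (n + m) z with hT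
  -- Replacing the weight H_{n+k} - H_{n+m} by ψ(n+k+1) = H_{n+k} - γ costs (γ - H_{n+m}) times
  -- f_{n+m}.
  have hU : K * (2 ^ n)⁻¹ * ∑ k ∈ Finset.range (n + 1), (n.choose k * (2 * ε) ^ (n - k)) *
        ((n + k).choose (n + m) * ((harmonic (n + k) : ℂ) - harmonic (n + m)) *
          (z - ε) ^ (n + k - (n + m))) =
      ε ^ (n + m) / 2 ^ m * (∑ k ∈ Finset.range (n - m + 1), ε ^ k *
        (((k + n + m).factorial * Complex.digamma (k + n + m + 1) : ℂ) /
          (k.factorial * (k + m).factorial * (n - m - k).factorial)) * ((z - ε) / 2) ^ k) +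
      (γ - harmonic (n + m)) * (K * (2 ^ n)⁻¹ * T) := by
    have a1 := sum_weighted_upper n m hmn (z - ε) ε hε2 (fun j => (harmonic j : ℂ) - γ)
    simp only [d2]
    rw [← a1, hT, legendreTaylor_eq_sum n (n + m) z ε hε2, ← hK, mul_left_comm, ← mul_add]
    congr 1
    rw [Finset.mul_sum, ← Finset.sum_add_distrib]
    exact Finset.sum_congr rfl fun k _ => by ring
  -- The digamma bracket equals H_{k+n} - H_{k+m} - H_k + γ, hence the surplus γ.
  have hV : K * (2 ^ n)⁻¹ * (((z ^ 2 - 1) ^ m)⁻¹ * ∑ k ∈ Finset.range (n + 1),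
        (n.choose k * (2 * ε) ^ (n - k)) *
        ((n + k).choose (n - m) * (z - ε) ^ (n + k - (n - m)) *
          ((harmonic (m + k) : ℂ) + harmonic k - harmonic (n + k)))) =
      -(ε ^ n * (((n + m).factorial : ℂ) / (n - m).factorial) / (z + ε) ^ m *
        ∑ k ∈ Finset.range (n + 1), ε ^ k *
          ((k + n).factorial / (k.factorial * (k + m).factorial * (n - k).factorial) : ℂ) *
          (Complex.digamma (k + n + 1) - Complex.digamma (k + m + 1)
            - Complex.digamma (k + 1)) * ((z - ε) / 2) ^ k) +
      γ * (K * (2 ^ n)⁻¹ * T) := by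
    have a1 := sum_weighted_lower n m hmn (z - ε) (z + ε) ε hε2 hy hw
      (fun k => (harmonic (k + n) : ℂ) - γ - (harmonic (k + m) - γ) - (harmonic k - γ))
    rw [hc] at a1
    simp only [d3, digamma_natCast_add_one]
    rw [← a1, hT, legendreTaylor_reflect_mid n m hmn z hc0,
      legendreTaylor_eq_sum n (n - m) z ε hε2, ← hK, mul_left_comm γ, mul_left_comm γ,
      ← mul_neg, ← mul_add, ← mul_neg, ← mul_add]
    congr 2
    rw [Finset.mul_sum, ← Finset.sum_neg_distrib, ← Finset.sum_add_distrib]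
    refine Finset.sum_congr rfl fun k _ => ?_
    rw [add_comm k n, add_comm k m]
    ring
  have hW := sum_finite_part n m hmn (z - ε) (z ^ 2 - 1) ε hε2
  rw [← hK] at hW
  rw [hQ, legendreQClosed, ← hA, ascPochhammer_eval_natCast_add_one, ← hK, ← hlog, hΦ,
    legendrePhi_sub_eq_sum n m hmn z ε hε2 hy hw, hP, hpow, quarterPow_div_two z h1 h2,
    quarterPow_neg_div_two z h1 h2, ← hA, ← hT, d1, digamma_natCast_add_one n, ← hγ]
  -- The surplus 2γ - H_{n+m}, together with -H_n from the expansion of Φ, is -(ψ(n+m+1) + ψ(n+1)).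
  linear_combination (1 / 2 * A * ε) * (hU + hV + hW)
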